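/- Let $2\le n\le\infty$, let $H\in\mathbb R$ be a constant, let $\mathcal D\subseteq\mathbb R^2$ be an open neighbourhood of $(u_0,v_0)$, and let $\nu:\mathcal D\to(0,\infty)$ be a function of class $C^n$ with $\nu_u\nu_v\neq 0$ on $\mathcal D$, satisfying $$\Delta\ln\nu=\frac{1}{\nu}(H^2-\nu^2),\qquad \Delta=\partial_u^2+\partial_v^2 .$$ Let $x_0\in\mathbb R^3$ be a point and let $X_0,Y_0,l_0=X_0\times Y_0$ be a right-oriented orthonormal frame of $\mathbb R^3$. Conventions. For a regular parametrized surface $x=x(u,v)$ let $E,F,G$ and $L,M,N$ be the coefficients of its first and second fundamental forms with respect to the unit normal $l=\frac{x_u\times x_v}{|x_u\times x_v|}$, and put $X=x_u/\sqrt E$, $Y=x_v/\sqrt G$. The parameters are principal if $F=M=0$; then $\nu_1=L/E$, $\nu_2=N/G$ are the principal curvatures and $\gamma_1=-\frac{E_v}{2E\sqrt G}$, $\gamma_2=\frac{G_u}{2G\sqrt E}$ are the geodesic curvatures of the principal lines. The surface is strongly regular if $(\nu_1-\nu_2)\gamma_1\gamma_2\ne0$ everywhere. For a surface with constant mean curvature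 $H$ and $\nu_1-\nu_2>0$ in principal parameters, with $\hat\nu=\frac12(\nu_1-\nu_2)$, $\hat\nu_u\hat\nu_v\neq0$, and $\hat\nu_0=\hat\nu(u_0,v_0)$, the parameters $(u,v)$ are canonical principal if the functions $$\ln\Big\{\sqrt E\,\exp\int_{\hat\nu_0}^{\hat\nu}\frac{dt}{2t}\Big\},\qquad \ln\Big\{\sqrt G\,\exp\int_{\hat\nu_0}^{\hat\nu}\frac{dt}{2t}\Big\}$$ are constant and $E(u_0,v_0)=G(u_0,v_0)=\frac1{2\hat\nu_0}$ (equivalently, $E=G=\frac{1}{\nu_1-\nu_2}$ everywhere). Consider the following conditions on a strongly regular surface $x=x(u,v)$ in principal parameters, defined on a connected open set containing $(u_0,v_0)$ and contained in $\mathcal D$: (i) $(u,v)$ are canonical principal parameters; (ii) $x(u_0,v_0)=x_0$, $X(u_0,v_0)=X_0$, $Y(u_0,v_0)=Y_0$, $l(u_0,v_0)=l_0$; (iii) the surface has constant mean curvature $H$, with invariants $$\nu_1=H+\nu,\quad \nu_2=H-\nu,\quad \gamma_1=(\sqrt{2\nu})_v,\quad \gamma_2=-(\sqrt{2\nu})_u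 .$$ Then there is a connected open set $\mathcal D_0$ with $(u_0,v_0)\in\mathcal D_0\subseteq\mathcal D$ on which a strongly regular surface of class $C^{n+1}$ with properties (i), (ii), (iii) exists. It is unique: on every connected open set $\mathcal D_1$ with $(u_0,v_0)\in\mathcal D_1\subseteq\mathcal D$, any two strongly regular surfaces of class $C^2$ with properties (i), (ii), (iii) coincide. -/

import Mathlib

open Set

namespace SurfaceTheory

/-- Euclidean three-space. -/
abbrev E3 : Type := EuclideanSpace ℝ (Fin 3)

/-- The vector product of Euclidean three-space. -/
noncomputable def cross (a b : E3) : E3 :=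
  WithLp.toLp 2 (crossProduct (WithLp.ofLp a) (WithLp.ofLp b))

/-- The partial derivative with respect to the first parameter `u`. -/
noncomputable def pdu {F : Type*} [NormedAddCommGroup F] [NormedSpace ℝ F]
    (f : ℝ × ℝ → F) (p : ℝ × ℝ) : F :=
  fderiv ℝ f p (1, 0)

/-- The partial derivative with respect to the second parameter `v`. -/
noncomputable def pdv {F : Type*} [NormedAddCommGroup F] [NormedSpace ℝ F]
    (f : ℝ × ℝ → F) (p : ℝ × ℝ) : F :=
  fderiv ℝ f p (0, 1)

/-! Fundamental forms of a parametrized surface `x = x(u, v)`. -/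

/-- The coefficient `E` of the first fundamental form. -/
noncomputable def coeffE (x : ℝ × ℝ → E3) (p : ℝ × ℝ) : ℝ := inner ℝ (pdu x p) (pdu x p)

/-- The coefficient `F` of the first fundamental form. -/
noncomputable def coeffF (x : ℝ × ℝ → E3) (p : ℝ × ℝ) : ℝ := inner ℝ (pdu x p) (pdv x p)

/-- The coefficient `G` of the first fundamental form. -/
noncomputable def coeffG (x : ℝ × ℝ → E3) (p : ℝ × ℝ) : ℝ := inner ℝ (pdv x p) (pdv x p)

/-- The unit normal `l` of the surface. -/
noncomputable def unitNormal (x : ℝ × ℝ → E3) (p : ℝ × ℝ) : E3 :=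
  ‖cross (pdu x p) (pdv x p)‖⁻¹ • cross (pdu x p) (pdv x p)

/-- The coefficient `L` of the second fundamental form. -/
noncomputable def coeffL (x : ℝ × ℝ → E3) (p : ℝ × ℝ) : ℝ :=
  inner ℝ (pdu (pdu x) p) (unitNormal x p)

/-- The coefficient `M` of the second fundamental form. -/
noncomputable def coeffM (x : ℝ × ℝ → E3) (p : ℝ × ℝ) : ℝ :=
  inner ℝ (pdv (pdu x) p) (unitNormal x p)

/-- The coefficient `N` of the second fundamental form. -/
noncomputable def coeffN (x : ℝ × ℝ → E3) (p : ℝ × ℝ) : ℝ :=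
  inner ℝ (pdv (pdv x) p) (unitNormal x p)

/-- The mean curvature of a surface in arbitrary regular parameters. -/
noncomputable def meanCurvature (x : ℝ × ℝ → E3) (p : ℝ × ℝ) : ℝ :=
  (coeffE x p * coeffN x p - 2 * coeffF x p * coeffM x p + coeffG x p * coeffL x p) /
    (2 * (coeffE x p * coeffG x p - coeffF x p ^ 2))

/-- The unit tangent field `X` of the `u`-lines. -/
noncomputable def tangentX (x : ℝ × ℝ → E3) (p : ℝ × ℝ) : E3 :=
  (Real.sqrt (coeffE x p))⁻¹ • pdu x p

/-- The unit tangent field `Y` of the `v`-lines. -/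
noncomputable def tangentY (x : ℝ × ℝ → E3) (p : ℝ × ℝ) : E3 :=
  (Real.sqrt (coeffG x p))⁻¹ • pdv x p

/-! The four invariants of a surface in principal parameters (`F = M = 0`). -/

/-- The principal curvature `ν₁ = L / E` (in principal parameters). -/
noncomputable def nu₁ (x : ℝ × ℝ → E3) (p : ℝ × ℝ) : ℝ := coeffL x p / coeffE x p

/-- The principal curvature `ν₂ = N / G` (in principal parameters). -/
noncomputable def nu₂ (x : ℝ × ℝ → E3) (p : ℝ × ℝ) : ℝ := coeffN x p / coeffG x p

/-- The geodesic curvature `γ₁ = - E_v / (2 E √G)` of the principal `u`-lines. -/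
noncomputable def gamma₁ (x : ℝ × ℝ → E3) (p : ℝ × ℝ) : ℝ :=
  -pdv (coeffE x) p / (2 * coeffE x p * Real.sqrt (coeffG x p))

/-- The geodesic curvature `γ₂ = G_u / (2 G √E)` of the principal `v`-lines. -/
noncomputable def gamma₂ (x : ℝ × ℝ → E3) (p : ℝ × ℝ) : ℝ :=
  pdu (coeffG x) p / (2 * coeffG x p * Real.sqrt (coeffE x p))

/-- `x` is a regular parametrized surface of class `C^k` on `D`. -/
structure IsRegularSurface (k : WithTop ℕ∞) (D : Set (ℝ × ℝ)) (x : ℝ × ℝ → E3) : Prop where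
  contDiffOn : ContDiffOn ℝ k x D
  immersion : ∀ p ∈ D, LinearIndependent ℝ ![pdu x p, pdv x p]

/-- The parametric net is principal: `F = M = 0`. -/
def IsPrincipal (D : Set (ℝ × ℝ)) (x : ℝ × ℝ → E3) : Prop :=
  ∀ p ∈ D, coeffF x p = 0 ∧ coeffM x p = 0

/-- A strongly regular surface of class `C^k` in principal parameters:
`(ν₁ - ν₂) γ₁ γ₂ ≠ 0` everywhere. -/
structure IsStronglyRegular (k : WithTop ℕ∞) (D : Set (ℝ × ℝ)) (x : ℝ × ℝ → E3) : Prop where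
  regular : IsRegularSurface k D x
  principal : IsPrincipal D x
  ne_zero : ∀ p ∈ D, (nu₁ x p - nu₂ x p) * gamma₁ x p * gamma₂ x p ≠ 0

/-- The surface `x`, in principal parameters, is Weingarten with determining functions `f`, `g`
on the interval `I`: `ν₁ = f(ν)`, `ν₂ = g(ν)`, where `f - g > 0`, `f' g' ≠ 0`, `ν_u ν_v ≠ 0`. -/
structure IsWeingarten (D : Set (ℝ × ℝ)) (x : ℝ × ℝ → E3) (I : Set ℝ) (f g : ℝ → ℝ)
    (ν : ℝ × ℝ → ℝ) : Prop where
  ordConnected : I.OrdConnected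
  diff_f : ∀ t ∈ I, DifferentiableAt ℝ f t
  diff_g : ∀ t ∈ I, DifferentiableAt ℝ g t
  sub_pos : ∀ t ∈ I, 0 < f t - g t
  deriv_ne : ∀ t ∈ I, deriv f t * deriv g t ≠ 0
  mem : ∀ p ∈ D, ν p ∈ I
  nu₁_eq : ∀ p ∈ D, nu₁ x p = f (ν p)
  nu₂_eq : ∀ p ∈ D, nu₂ x p = g (ν p)
  partial_ne : ∀ p ∈ D, pdu ν p * pdv ν p ≠ 0

/-- The function `λ = ln (√E exp (∫ f' dν / (f - g)))`, the integral being taken from `t₀`. -/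
noncomputable def lam (x : ℝ × ℝ → E3) (f g : ℝ → ℝ) (ν : ℝ × ℝ → ℝ) (t₀ : ℝ) (p : ℝ × ℝ) : ℝ :=
  Real.log (Real.sqrt (coeffE x p) * Real.exp (∫ t in t₀..ν p, deriv f t / (f t - g t)))

/-- The function `μ = ln (√G exp (∫ g' dν / (g - f)))`, the integral being taken from `t₀`. -/
noncomputable def mu (x : ℝ × ℝ → E3) (f g : ℝ → ℝ) (ν : ℝ × ℝ → ℝ) (t₀ : ℝ) (p : ℝ × ℝ) : ℝ :=
  Real.log (Real.sqrt (coeffG x p) * Real.exp (∫ t in t₀..ν p, deriv g t / (g t - f t)))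

/-- The parameters `(u, v)` are geometric principal: they are principal, the surface is Weingarten
and the functions `λ` and `μ` are constant. -/
structure IsGeometricPrincipal (D : Set (ℝ × ℝ)) (x : ℝ × ℝ → E3) (I : Set ℝ) (f g : ℝ → ℝ)
    (ν : ℝ × ℝ → ℝ) (t₀ : ℝ) : Prop where
  principal : IsPrincipal D x
  weingarten : IsWeingarten D x I f g ν
  lam_const : ∃ c : ℝ, ∀ p ∈ D, lam x f g ν t₀ p = c
  mu_const : ∃ c : ℝ, ∀ p ∈ D, mu x f g ν t₀ p = c

/-- Half the difference of the principal curvatures. -/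
noncomputable def halfDiff (x : ℝ × ℝ → E3) (p : ℝ × ℝ) : ℝ := (nu₁ x p - nu₂ x p) / 2

/-- The parameters `(u, v)` are canonical principal for the surface `x` of constant mean
curvature `H`: with `ν = (ν₁ - ν₂) / 2 > 0`, so that `ν₁ = H + ν` and `ν₂ = H - ν`, they are
geometric principal and normalized by `1 / a² = E(p₀) = G(p₀)` with `a² = 2 ν(p₀)`.
(It follows that `E = G = 1 / (2 ν)` everywhere.) -/
structure IsCanonicalPrincipal (H : ℝ) (D : Set (ℝ × ℝ)) (p₀ : ℝ × ℝ) (x : ℝ × ℝ → E3) :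
    Prop where
  geometric : IsGeometricPrincipal D x (Ioi 0) (fun t => H + t) (fun t => H - t)
    (halfDiff x) (halfDiff x p₀)
  coeffE_base : coeffE x p₀ = 1 / (2 * halfDiff x p₀)
  coeffG_base : coeffG x p₀ = 1 / (2 * halfDiff x p₀)

/-- `x` is, on the parameter domain `D`, a strongly regular surface of class `C^k` such that
(i) `(u, v)` are canonical principal parameters, (ii) `x` has the prescribed initial position and
frame at `p₀`, (iii) `x` has constant mean curvature `H` and the prescribed four invariants. -/
structure IsCMCSurface (k : WithTop ℕ∞) (H : ℝ) (ν : ℝ × ℝ → ℝ) (p₀ : ℝ × ℝ)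
    (x₀ X₀ Y₀ l₀ : E3) (D : Set (ℝ × ℝ)) (x : ℝ × ℝ → E3) : Prop where
  stronglyRegular : IsStronglyRegular k D x
  canonical : IsCanonicalPrincipal H D p₀ x
  init_point : x p₀ = x₀
  init_X : tangentX x p₀ = X₀
  init_Y : tangentY x p₀ = Y₀
  init_l : unitNormal x p₀ = l₀
  meanCurvature_eq : ∀ p ∈ D, meanCurvature x p = H
  nu₁_eq : ∀ p ∈ D, nu₁ x p = H + ν p
  nu₂_eq : ∀ p ∈ D, nu₂ x p = H - ν p
  gamma₁_eq : ∀ p ∈ D, gamma₁ x p = pdv (fun q => Real.sqrt (2 * ν q)) p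
  gamma₂_eq : ∀ p ∈ D, gamma₂ x p = -pdu (fun q => Real.sqrt (2 * ν q)) p

end SurfaceTheory

/-! This is a theorem of Bonnet type. Canonical parameters force E = G = 1/(2ν), so x_u = sX and x_v
= sY with s = 1/√(2ν). The frame (X, Y, l) then solves a linear first order system whose
coefficients depend only on ν and H: the connection form has components a₁ = ν_v/(2ν) and a₂ =
-ν_u/(2ν), and the normal parts are b = (H + ν)s and d = (H - ν)s. In terms of these coefficients,
the compatibility of dx and the two Codazzi equations hold identically because H is constant. The
Gauss equation (a₂)_u - (a₁)_v = -bd is exactly Δ ln ν = (H² - ν²)/ν.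

Existence: the system has the form dW = ρ(A)W with flat A, and `TotalDifferential.exists_solution`
integrates it by solving an ODE along each ray from p₀. The connection matrix is skew, so the frame
stays orthonormal and right-oriented. All invariants can then be read off the frame
(`IsFramedSurface.isCMCSurface`).

Uniqueness: conversely, the frame of any surface with (i), (ii), (iii) solves the same system
(`IsCMCSurface.isFramedSurface`). For two solutions the sum of the inner products of corresponding
vectors is constant. It equals 3 at p₀, so the frames agree everywhere, and hence so do the
surfaces. -/

namespace TotalDifferential

/-! ### Total linear differential equations dW = ρ(A)W -/

open Metric

variable {V E G : Type*} [NormedAddCommGroup V] [NormedSpace ℝ V]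
  [NormedAddCommGroup E] [NormedSpace ℝ E] [NormedAddCommGroup G] [NormedSpace ℝ G]

/-- With zero initial value the Gronwall bound is linear in the inhomogeneity ε. The factor does not
depend on ε, so errors of order o(‖h‖) on the right-hand side remain o(‖h‖) in the solution. -/
theorem norm_le_mul_gronwallBound {f f' : ℝ → E} {K ε : ℝ} (hK : 0 ≤ K) (hε : 0 ≤ ε)
    (hf : ∀ t ∈ Icc (0 : ℝ) 1, HasDerivWithinAt f (f' t) (Icc 0 1) t) (h0 : f 0 = 0)
    (bound : ∀ t ∈ Icc (0 : ℝ) 1, ‖f' t‖ ≤ K * ‖f t‖ + ε) :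
    ∀ t ∈ Icc (0 : ℝ) 1, ‖f t‖ ≤ ε * gronwallBound 0 K 1 1 := by
  intro t ht
  have h1 := norm_le_gronwallBound_of_norm_deriv_right_le (f := f) (f' := f') (δ := 0) (K := K)
    (ε := ε) (a := 0) (b := 1) (fun t ht => (hf t ht).continuousWithinAt)
    (fun t ht => ((hf t (Ico_subset_Icc_self ht)).mono_of_mem_nhdsWithin
      (Icc_mem_nhdsGE_of_mem ht))) (by simp [h0])
    (fun t ht => bound t (Ico_subset_Icc_self ht)) t ht
  have h2 : gronwallBound 0 K ε 1 = ε * gronwallBound 0 K 1 1 := by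
    unfold gronwallBound
    split_ifs <;> simp
    ring
  rw [← h2]
  refine h1.trans (gronwallBound_mono le_rfl hε hK ?_)
  linarith [ht.2]

theorem exists_linear_ode_solution [CompleteSpace E] {B : ℝ → E →L[ℝ] E} {m : ℝ} (w₀ : E)
    (hB : ContinuousOn B (Icc 0 1)) (hm : ∀ t ∈ Icc (0 : ℝ) 1, ‖B t‖ ≤ m)
    (hmw : m * (‖w₀‖ + 1) ≤ 1) :
    ∃ y : ℝ → E, y 0 = w₀ ∧
      (∀ t ∈ Icc (0 : ℝ) 1, HasDerivWithinAt y (B t (y t)) (Icc 0 1) t) ∧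
      ∀ t ∈ Icc (0 : ℝ) 1, ‖y t‖ ≤ gronwallBound ‖w₀‖ m 0 1 := by
  have hm0 : 0 ≤ m := (norm_nonneg _).trans (hm 0 (by simp))
  -- Starting at w₀, the solution is sought in the closed unit ball about w₀, where ‖B w‖ ≤ m(‖w₀‖ +
  -- 1) ≤ 1. With speed at most 1 it cannot leave that ball before time 1.
  have hPL : IsPicardLindelof (fun t w => B t w) (tmin := 0) (tmax := 1)
      ⟨0, by simp⟩ w₀ 1 0 1 ⟨m, hm0⟩ := by
    refine ⟨fun t ht => ?_, fun w _ => hB.clm_apply continuousOn_const, fun t ht w hw => ?_, by simp⟩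
    · refine LipschitzOnWith.of_dist_le_mul fun a _ b _ => ?_
      rw [dist_eq_norm, dist_eq_norm, ← map_sub]
      exact (B t).le_of_opNorm_le (hm t ht) _
    · have hw' : ‖w‖ ≤ ‖w₀‖ + 1 := by
        have : ‖w - w₀‖ ≤ 1 := by simpa [dist_eq_norm] using hw
        linarith [norm_le_norm_add_norm_sub' w w₀]
      calc ‖B t w‖ ≤ m * ‖w‖ := (B t).le_of_opNorm_le (hm t ht) _
        _ ≤ m * (‖w₀‖ + 1) := by gcongr
        _ ≤ 1 := hmw
  obtain ⟨y, hy0, hy⟩ := hPL.exists_eq_forall_mem_Icc_hasDerivWithinAt₀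
  refine ⟨y, hy0, hy, fun t ht => ?_⟩
  have h1 := norm_le_gronwallBound_of_norm_deriv_right_le (f := y) (δ := ‖w₀‖) (K := m)
    (ε := 0) (a := 0) (b := 1) (fun t ht => (hy t ht).continuousWithinAt)
    (fun t ht => ((hy t (Ico_subset_Icc_self ht)).mono_of_mem_nhdsWithin
      (Icc_mem_nhdsGE_of_mem ht))) (le_of_eq (congrArg _ hy0))
    (fun t ht => by
      rw [add_zero]
      exact (B t).le_of_opNorm_le (hm t (Ico_subset_Icc_self ht)) _) t ht
  refine h1.trans (gronwallBound_mono (norm_nonneg _) le_rfl hm0 ?_)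
  linarith [ht.2]

/-- On a compact convex set, the first order expansion of a `C¹` map is uniform. -/
theorem exists_uniform_expansion {A : V → G} {A' : V → V →L[ℝ] G} {s : Set V}
    (hs : IsCompact s) (hc : Convex ℝ s) (hA : ∀ p ∈ s, HasFDerivAt A (A' p) p)
    (hA' : ContinuousOn A' s) {ε : ℝ} (hε : 0 < ε) :
    ∃ δ > 0, ∀ p ∈ s, ∀ q ∈ s, ‖q - p‖ < δ → ‖A q - A p - A' p (q - p)‖ ≤ ε * ‖q - p‖ := by
  obtain ⟨δ, hδ, h⟩ := Metric.uniformContinuousOn_iff.1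
    (hs.uniformContinuousOn_of_continuous hA') ε hε
  refine ⟨δ, hδ, fun p hp q hq hpq => ?_⟩
  have hsub : segment ℝ p q ⊆ s := hc.segment_subset hp hq
  refine Convex.norm_image_sub_le_of_norm_hasFDerivWithin_le' (s := segment ℝ p q) (f' := A')
    (fun x hx => (hA x (hsub hx)).hasFDerivWithinAt) (fun x hx => ?_)
    (convex_segment p q) (left_mem_segment _ _ _) (right_mem_segment _ _ _)
  rw [← dist_eq_norm]
  refine (h x (hsub hx) p hp ?_).le
  have h2 : segment ℝ p q ⊆ ball p δ :=
    (convex_ball p δ).segment_subset (mem_ball_self hδ) (by simpa [dist_eq_norm] using hpq)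
  exact h2 hx

set_option maxHeartbeats 400000 in
/-- Local solvability of the total linear differential equation `dW = ρ(A) W`, for a coefficient
form `A` satisfying the integrability condition. -/
theorem exists_solution [ProperSpace V] [CompleteSpace E] (ρ : G →L[ℝ] E →L[ℝ] E)
    {A : V → V →L[ℝ] G} {A' : V → V →L[ℝ] V →L[ℝ] G} {s : Set V} (hs : IsOpen s)
    {p₀ : V} (hp₀ : p₀ ∈ s)
    (hA : ∀ p ∈ s, HasFDerivAt A (A' p) p) (hA' : ContinuousOn A' s)
    (flat : ∀ p ∈ s, ∀ a b w, ρ (A' p a b) w + ρ (A p b) (ρ (A p a) w) =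
      ρ (A' p b a) w + ρ (A p a) (ρ (A p b) w)) (w₀ : E) :
    ∃ r > 0, ball p₀ r ⊆ s ∧ ∃ W : V → E, W p₀ = w₀ ∧
      ∀ p ∈ ball p₀ r, HasFDerivAt W ((ρ.flip (W p)).comp (A p)) p := by
  obtain ⟨R, hR, hRs⟩ := Metric.nhds_basis_closedBall.mem_iff.1 (hs.mem_nhds hp₀)
  have hcpt : IsCompact (closedBall p₀ R) := isCompact_closedBall p₀ R
  have hAc : ContinuousOn A s := fun p hp => (hA p hp).continuousAt.continuousWithinAt
  obtain ⟨M₁, hM₁⟩ : ∃ M, ∀ p ∈ closedBall p₀ R, ‖A p‖ ≤ M :=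
    hcpt.exists_bound_of_continuousOn (hAc.mono hRs)
  obtain ⟨N₁, hN₁⟩ : ∃ N, ∀ p ∈ closedBall p₀ R, ‖A' p‖ ≤ N :=
    hcpt.exists_bound_of_continuousOn (E := V →L[ℝ] V →L[ℝ] G) (hA'.mono hRs)
  have hM₁0 : 0 ≤ M₁ := (norm_nonneg _).trans (hM₁ p₀ (mem_closedBall_self hR.le))
  have hN₁0 : 0 ≤ N₁ := (A' p₀).opNorm_nonneg.trans (hN₁ p₀ (mem_closedBall_self hR.le))
  set M := ‖ρ‖ * M₁ with hMdef
  set N := ‖ρ‖ * N₁ with hNdef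
  have hM0 : 0 ≤ M := by positivity
  have hN0 : 0 ≤ N := by positivity
  have hM : ∀ p ∈ closedBall p₀ R, ∀ k, ‖ρ (A p k)‖ ≤ M * ‖k‖ := fun p hp k => by
    rw [hMdef, mul_assoc]
    exact ρ.le_opNorm_of_le ((A p).le_of_opNorm_le (hM₁ p hp) k)
  -- The last inequality is the smallness condition of `exists_linear_ode_solution` along rays of
  -- length less than r; r ≤ 1 lets factors ‖k‖ be dropped later.
  obtain ⟨r, hr, hrR, hr1, hrM⟩ : ∃ r > 0, r ≤ R ∧ r ≤ 1 ∧ M * r * (‖w₀‖ + 1) ≤ 1 := by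
    have hpos : 0 < M * (‖w₀‖ + 1) + 1 := by positivity
    refine ⟨min (min R 1) (1 / (M * (‖w₀‖ + 1) + 1)), by positivity,
      (min_le_left _ _).trans (min_le_left _ _), (min_le_left _ _).trans (min_le_right _ _), ?_⟩
    calc M * min (min R 1) (1 / (M * (‖w₀‖ + 1) + 1)) * (‖w₀‖ + 1)
        ≤ M * (1 / (M * (‖w₀‖ + 1) + 1)) * (‖w₀‖ + 1) := by gcongr; exact min_le_right _ _
      _ = M * (‖w₀‖ + 1) / (M * (‖w₀‖ + 1) + 1) := by ring
      _ ≤ 1 := by rw [div_le_one hpos]; linarith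
  have hray : ∀ k : V, ‖k‖ < r → ∀ t ∈ Icc (0 : ℝ) 1, p₀ + t • k ∈ closedBall p₀ R := by
    intro k hk t ht
    rw [mem_closedBall, dist_eq_norm, add_sub_cancel_left, norm_smul, Real.norm_of_nonneg ht.1]
    nlinarith [norm_nonneg k, ht.2, ht.1]
  have hmul : ∀ k : V, ‖k‖ < r → ∀ t ∈ Icc (0 : ℝ) 1, ‖ρ (A (p₀ + t • k) k)‖ ≤ M * r :=
    fun k hk t ht => (hM _ (hray k hk t ht) k).trans (by gcongr)
  -- The function `y k` is the solution along the ray t ↦ p₀ + tk, and `W (p₀ + k)` will be `y k 1`.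
  -- For ‖k‖ ≥ r the value is junk, which lets `choose` produce a total family.
  have hsol : ∀ k : V, ∃ y : ℝ → E, ‖k‖ < r → y 0 = w₀ ∧
      (∀ t ∈ Icc (0 : ℝ) 1, HasDerivWithinAt y (ρ (A (p₀ + t • k) k) (y t)) (Icc 0 1) t) ∧
      ∀ t ∈ Icc (0 : ℝ) 1, ‖y t‖ ≤ gronwallBound ‖w₀‖ (M * r) 0 1 := by
    intro k
    by_cases hk : ‖k‖ < r
    · obtain ⟨y, h⟩ := exists_linear_ode_solution (B := fun t => ρ (A (p₀ + t • k) k)) w₀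
        (ρ.continuous.comp_continuousOn
          (((hAc.mono hRs).comp (by fun_prop) (hray k hk)).clm_apply continuousOn_const))
        (hmul k hk) hrM
      exact ⟨y, fun _ => h⟩
    · exact ⟨0, fun h => absurd h hk⟩
  choose y hy using hsol
  set C := gronwallBound ‖w₀‖ (M * r) 0 1 with hC
  have hC0 : 0 ≤ C := (norm_nonneg _).trans ((hy 0 (by simpa using hr)).2.2 0 (by simp))
  set g := gronwallBound 0 (M * r) 1 1 with hg
  have hMr : 0 ≤ M * r := by positivity
  have hg0 : 0 ≤ g := by
    have := gronwallBound_mono (δ := 0) (ε := 1) le_rfl zero_le_one hMr zero_le_one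
    rwa [gronwallBound_x0] at this
  have hball : ball p₀ r ⊆ s :=
    (ball_subset_closedBall.trans (closedBall_subset_closedBall hrR)).trans hRs
  have hLip : ∀ p ∈ closedBall p₀ R, ∀ q ∈ closedBall p₀ R, ‖A q - A p‖ ≤ N₁ * ‖q - p‖ :=
    fun p hp q hq => (convex_closedBall p₀ R).norm_image_sub_le_of_norm_hasFDerivWithin_le
      (fun x hx => (hA x (hRs hx)).hasFDerivWithinAt) hN₁ hp hq
  have hdiff : ∀ k h l : V, ‖k‖ < r → ‖k + h‖ < r → ∀ t ∈ Icc (0 : ℝ) 1,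
      ‖ρ ((A (p₀ + t • (k + h)) - A (p₀ + t • k)) l)‖ ≤ N * ‖h‖ * ‖l‖ := by
    intro k h l hk hkh t ht
    rw [hNdef, mul_assoc, mul_assoc]
    refine ρ.le_opNorm_of_le ((ContinuousLinearMap.le_of_opNorm_le _
      (hLip _ (hray k hk t ht) _ (hray _ hkh t ht)) l).trans ?_)
    have : p₀ + t • (k + h) - (p₀ + t • k) = t • h := by module
    rw [this, norm_smul, Real.norm_of_nonneg ht.1, mul_assoc]
    have : t * ‖h‖ ≤ ‖h‖ := mul_le_of_le_one_left (norm_nonneg _) ht.2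
    gcongr
  have hcoef : ∀ k h : V, ‖k‖ < r → ‖k + h‖ < r → ∀ t ∈ Icc (0 : ℝ) 1,
      ‖ρ (A (p₀ + t • (k + h)) (k + h)) - ρ (A (p₀ + t • k) k)‖ ≤ (N + M) * ‖h‖ := by
    intro k h hk hkh t ht
    have e : ρ (A (p₀ + t • (k + h)) (k + h)) - ρ (A (p₀ + t • k) k) =
        ρ ((A (p₀ + t • (k + h)) - A (p₀ + t • k)) k) + ρ (A (p₀ + t • (k + h)) h) := by
      simp only [map_add, map_sub, sub_apply]; abel
    rw [e]
    refine (norm_add_le _ _).trans ?_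
    have h1 := hdiff k h k hk hkh t ht
    have h2 := hM _ (hray _ hkh t ht) h
    have h3 : N * ‖h‖ * ‖k‖ ≤ N * ‖h‖ * 1 := by gcongr; linarith
    linarith
  -- Lipschitz dependence on the endpoint of the ray: the difference of two ray solutions satisfies
  -- the linear equation for k up to an error of order ‖h‖.
  have hd : ∀ k h : V, ‖k‖ < r → ‖k + h‖ < r → ∀ t ∈ Icc (0 : ℝ) 1,
      ‖y (k + h) t - y k t‖ ≤ (N + M) * ‖h‖ * C * g := by
    intro k h hk hkh
    refine norm_le_mul_gronwallBound (f := fun t => y (k + h) t - y k t) hMr (by positivity)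
      (fun t ht => ((hy _ hkh).2.1 t ht).sub ((hy _ hk).2.1 t ht))
      (by simp [(hy _ hkh).1, (hy _ hk).1]) (fun t ht => ?_)
    have e : ρ (A (p₀ + t • (k + h)) (k + h)) (y (k + h) t) - ρ (A (p₀ + t • k) k) (y k t) =
        ρ (A (p₀ + t • k) k) (y (k + h) t - y k t) +
          (ρ (A (p₀ + t • (k + h)) (k + h)) - ρ (A (p₀ + t • k) k)) (y (k + h) t) := by
      simp only [map_sub, sub_apply]; abel
    rw [e]
    refine (norm_add_le _ _).trans (add_le_add ?_ ?_)
    · exact ContinuousLinearMap.le_of_opNorm_le _ (hmul k hk t ht) _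
    · exact (ContinuousLinearMap.le_of_opNorm_le _ (hcoef k h hk hkh t ht) _).trans
        (by gcongr; exact (hy _ hkh).2.2 t ht)
  refine ⟨r, hr, hball, fun p => y (p - p₀) 1, ?_, ?_⟩
  · have h0 : ‖(0 : V)‖ < r := by simpa using hr
    -- Along the ray k = 0 the derivative vanishes, so the solution stays at w₀.
    have := norm_le_mul_gronwallBound (f := fun t => y 0 t - w₀) (f' := fun _ => 0) (K := 0)
      (ε := 0) le_rfl le_rfl
      (fun t ht => by simpa using ((hy _ h0).2.1 t ht).sub_const w₀)
      (by simp [(hy _ h0).1]) (fun t _ => by simp) 1 (by simp)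
    simpa [sub_eq_zero] using this
  intro p hp
  obtain ⟨k, rfl⟩ : ∃ k, p = p₀ + k := ⟨p - p₀, by abel⟩
  have hk : ‖k‖ < r := by simpa [dist_eq_norm] using hp
  rw [hasFDerivAt_iff_isLittleO_nhds_zero, Asymptotics.isLittleO_iff]
  intro c hc
  obtain ⟨ε, hε, hεc⟩ : ∃ ε > 0, ‖ρ‖ * ε * (C * g) ≤ c / 2 := by
    refine ⟨c / 2 / (‖ρ‖ * (C * g) + 1), by positivity, ?_⟩
    rw [mul_div_assoc', div_mul_eq_mul_div, div_le_iff₀ (by positivity)]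
    nlinarith [mul_nonneg (norm_nonneg ρ) (mul_nonneg hC0 hg0)]
  obtain ⟨δ, hδ, hexp⟩ := exists_uniform_expansion hcpt (convex_closedBall p₀ R)
    (fun p hp => hA p (hRs hp)) (hA'.mono hRs) hε
  -- Q collects the coefficients of ‖h‖² in the final estimate; the expansion error of A contributes
  -- the remaining term, at most (c/2)‖h‖.
  set Q := ((N + M) * ((N + M) * C * g) + N * C) * g with hQ
  have hQ0 : 0 ≤ Q := by positivity
  have hev : ∀ᶠ h : V in nhds 0, ‖h‖ < min (min δ (r - ‖k‖)) (c / 2 / (Q + 1)) := by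
    have : 0 < r - ‖k‖ := by linarith
    have : (0 : ℝ) < min (min δ (r - ‖k‖)) (c / 2 / (Q + 1)) := by positivity
    filter_upwards [Metric.ball_mem_nhds (0 : V) this] with h hh using mem_ball_zero_iff.1 hh
  filter_upwards [hev] with h hh
  simp only [lt_min_iff] at hh
  obtain ⟨⟨hh1, hh2⟩, hh3⟩ := hh
  have hkh : ‖k + h‖ < r := (norm_add_le _ _).trans_lt (by linarith)
  have hlin : ∀ t : ℝ, HasDerivAt (fun t : ℝ => p₀ + t • k) k t := fun t => by
    simpa using ((hasDerivAt_id t).smul_const k).const_add p₀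
  -- The expected first variation of `y k` in direction h is t ρ(A h) y, which at t = 1 is the
  -- claimed derivative. Subtracting it from the true difference leaves a function that vanishes at
  -- 0 and, by flatness, solves the equation for k up to a small error.
  have key := norm_le_mul_gronwallBound (K := M * r)
    (ε := (N + M) * ‖h‖ * ((N + M) * ‖h‖ * C * g) + (‖ρ‖ * (ε * ‖h‖) + N * ‖h‖ * ‖h‖) * C)
    (f := fun t => y (k + h) t - y k t - t • ρ (A (p₀ + t • k) h) (y k t))
    (f' := fun t => ρ (A (p₀ + t • (k + h)) (k + h)) (y (k + h) t) -
      ρ (A (p₀ + t • k) k) (y k t) -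
      (t • (ρ (A' (p₀ + t • k) k h) (y k t) +
        ρ (A (p₀ + t • k) h) (ρ (A (p₀ + t • k) k) (y k t))) +
        (1 : ℝ) • ρ (A (p₀ + t • k) h) (y k t))) hMr (by positivity)
    (fun t ht => by
      have hy1 := (hy _ hk).2.1 t ht
      have hAt := ((hA _ (hRs (hray k hk t ht))).comp_hasDerivAt t (hlin t)).hasDerivWithinAt
        (s := Icc (0 : ℝ) 1)
      have hAh := (ρ.hasFDerivAt.comp_hasDerivWithinAt t
        (hAt.clm_apply (hasDerivWithinAt_const t (Icc (0 : ℝ) 1) h))).clm_apply hy1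
      simp only [Function.comp_apply, map_zero, add_zero] at hAh
      exact (((hy _ hkh).2.1 t ht).sub hy1).sub ((hasDerivWithinAt_id t _).smul hAh))
    (by simp [(hy _ hk).1, (hy _ hkh).1])
    (fun t ht => by
      have hp := hRs (hray k hk t ht)
      have e : ρ (A (p₀ + t • (k + h)) (k + h)) (y (k + h) t) - ρ (A (p₀ + t • k) k) (y k t) -
          (t • (ρ (A' (p₀ + t • k) k h) (y k t) +
            ρ (A (p₀ + t • k) h) (ρ (A (p₀ + t • k) k) (y k t))) +
          (1 : ℝ) • ρ (A (p₀ + t • k) h) (y k t)) =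
          ρ (A (p₀ + t • k) k) (y (k + h) t - y k t - t • ρ (A (p₀ + t • k) h) (y k t)) +
          ((ρ (A (p₀ + t • (k + h)) (k + h)) - ρ (A (p₀ + t • k) k)) (y (k + h) t - y k t) +
          (ρ ((A (p₀ + t • (k + h)) - A (p₀ + t • k) - A' (p₀ + t • k) (t • h)) k) +
            ρ ((A (p₀ + t • (k + h)) - A (p₀ + t • k)) h)) (y k t)) := by
        -- Flatness exchanges k and h. One resulting term is absorbed into ρ(A k) acting on the
        -- remainder, and the other is the linear part of the increment of A.
        rw [flat _ hp k h]
        simp only [map_sub, map_add, map_smul, sub_apply,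
          add_apply, smul_apply]
        module
      rw [e]
      refine (norm_add_le _ _).trans (add_le_add ?_ ((norm_add_le _ _).trans (add_le_add ?_ ?_)))
      · exact ContinuousLinearMap.le_of_opNorm_le _ (hmul k hk t ht) _
      · exact (ContinuousLinearMap.le_of_opNorm_le _ (hcoef k h hk hkh t ht) _).trans
          (by gcongr; exact hd k h hk hkh t ht)
      · refine (ContinuousLinearMap.le_opNorm _ _).trans ?_
        gcongr
        · refine (norm_add_le _ _).trans (add_le_add ?_ (hdiff k h h hk hkh t ht))
          have e2 : p₀ + t • (k + h) - (p₀ + t • k) = t • h := by module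
          have hth : ‖t • h‖ ≤ ‖h‖ := by
            rw [norm_smul, Real.norm_of_nonneg ht.1]
            exact mul_le_of_le_one_left (norm_nonneg _) ht.2
          have h1 := hexp _ (hray k hk t ht) _ (hray _ hkh t ht) (by
            rw [e2]; exact hth.trans_lt hh1)
          rw [e2] at h1
          refine ρ.le_opNorm_of_le ((ContinuousLinearMap.le_of_opNorm_le _ h1 k).trans ?_)
          calc ε * ‖t • h‖ * ‖k‖ ≤ ε * ‖h‖ * 1 := by gcongr; linarith
            _ = ε * ‖h‖ := mul_one _
        · exact (hy _ hk).2.2 t ht) 1 (by simp)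
  simp only [one_smul] at key
  have e3 : p₀ + k + h - p₀ = k + h := by abel
  simp only [e3, add_sub_cancel_left, ContinuousLinearMap.flip_apply,
    ContinuousLinearMap.comp_apply]
  refine key.trans ?_
  have h4 : Q * ‖h‖ ≤ c / 2 := by
    rw [lt_div_iff₀ (by positivity), mul_add, mul_one, mul_comm ‖h‖ Q] at hh3
    linarith [norm_nonneg h]
  calc _ = (Q * ‖h‖ + ‖ρ‖ * ε * (C * g)) * ‖h‖ := by rw [hQ]; ring
    _ ≤ c * ‖h‖ := by gcongr; linarith

/-- Solutions of a total linear differential equation are one degree smoother than its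
coefficients. -/
theorem contDiffOn_solution (ρ : G →L[ℝ] E →L[ℝ] E) {A : V → V →L[ℝ] G} {s : Set V}
    (hs : IsOpen s) {W : V → E}
    (hW : ∀ p ∈ s, HasFDerivAt W ((ρ.flip (W p)).comp (A p)) p) {m : ℕ∞}
    (hA : ContDiffOn ℝ m A s) : ContDiffOn ℝ ((m : WithTop ℕ∞) + 1) W s := by
  have hfd : ∀ p ∈ s, fderiv ℝ W p = (ρ.flip (W p)).comp (A p) := fun p hp => (hW p hp).fderiv
  have hdiff : DifferentiableOn ℝ W s := fun p hp =>
    (hW p hp).differentiableAt.differentiableWithinAt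
  have step : ∀ j : ℕ∞, j ≤ m → ContDiffOn ℝ j W s →
      ContDiffOn ℝ ((j : WithTop ℕ∞) + 1) W s := by
    intro j hj hWj
    rw [contDiffOn_succ_iff_fderiv_of_isOpen hs]
    refine ⟨hdiff, by simp, ContDiffOn.congr ?_ hfd⟩
    have hρ : ContDiff ℝ j (fun w : E => ρ.flip w) :=
      IsBoundedLinearMap.contDiff (𝕜 := ℝ) ⟨⟨map_add _, map_smul _⟩, ‖ρ.flip‖ + 1,
        by positivity, fun w => (ρ.flip.le_opNorm w).trans (by gcongr; linarith)⟩
    exact (hρ.comp_contDiffOn hWj).clm_comp (hA.of_le (WithTop.coe_le_coe.2 hj))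
  have fin : ∀ j : ℕ, (j : ℕ∞) ≤ m → ContDiffOn ℝ (j : ℕ∞) W s := by
    intro j
    induction j with
    | zero => intro _; simpa using (contDiffOn_zero (𝕜 := ℝ)).2 hdiff.continuousOn
    | succ j ih =>
      intro hj
      have hj' : (j : ℕ∞) ≤ m := le_trans (by exact_mod_cast Nat.le_succ j) hj
      simpa using step j hj' (ih hj')
  refine step m le_rfl ?_
  induction m using ENat.recTopCoe with
  | top => exact contDiffOn_infty.2 fun j => by simpa using fin j le_top
  | coe m => exact fin m le_rfl

end TotalDifferential

/-! ### Vector algebra in space and rules for partial derivatives -/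

namespace SurfaceTheory

theorem inner_eq_sum (a b : E3) : inner ℝ a b = a 0 * b 0 + a 1 * b 1 + a 2 * b 2 := by
  simp [PiLp.inner_apply, Fin.sum_univ_three, mul_comm]

theorem cross_apply_zero (a b : E3) : cross a b 0 = a 1 * b 2 - a 2 * b 1 := by
  simp [cross, cross_apply]

theorem cross_apply_one (a b : E3) : cross a b 1 = a 2 * b 0 - a 0 * b 2 := by
  simp [cross, cross_apply]

theorem cross_apply_two (a b : E3) : cross a b 2 = a 0 * b 1 - a 1 * b 0 := by
  simp [cross, cross_apply]

theorem inner_cross_left (a b : E3) : inner ℝ (cross a b) a = 0 := by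
  simp only [inner_eq_sum, cross_apply_zero, cross_apply_one, cross_apply_two]; ring

theorem inner_cross_right (a b : E3) : inner ℝ (cross a b) b = 0 := by
  simp only [inner_eq_sum, cross_apply_zero, cross_apply_one, cross_apply_two]; ring

theorem inner_cross_self (a b : E3) : inner ℝ (cross a b) (cross a b) =
    inner ℝ a a * inner ℝ b b - (inner ℝ a b : ℝ) ^ 2 := by
  simp only [inner_eq_sum, cross_apply_zero, cross_apply_one, cross_apply_two]; ring

theorem cross_smul_smul (s t : ℝ) (a b : E3) : cross (s • a) (t • b) = (s * t) • cross a b := by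
  ext i
  fin_cases i <;>
    simp [cross_apply_zero, cross_apply_one, cross_apply_two] <;> ring

theorem differentiableAt_cross {f g : ℝ × ℝ → E3} {p : ℝ × ℝ} (hf : DifferentiableAt ℝ f p)
    (hg : DifferentiableAt ℝ g p) : DifferentiableAt ℝ (fun q => cross (f q) (g q)) p := by
  rw [differentiableAt_euclidean] at hf hg ⊢
  have f0 := hf 0
  have f1 := hf 1
  have f2 := hf 2
  have g0 := hg 0
  have g1 := hg 1
  have g2 := hg 2
  intro i
  fin_cases i <;> simp only [Fin.zero_eta, Fin.mk_one, Fin.reduceFinMk, cross_apply_zero,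
    cross_apply_one, cross_apply_two] <;> fun_prop

theorem orthonormal_triple_iff {a b c : E3} : Orthonormal ℝ ![a, b, c] ↔
    (inner ℝ a a = (1 : ℝ) ∧ inner ℝ b b = (1 : ℝ) ∧ inner ℝ c c = (1 : ℝ)) ∧
      inner ℝ a b = (0 : ℝ) ∧ inner ℝ a c = (0 : ℝ) ∧ inner ℝ b c = (0 : ℝ) := by
  rw [orthonormal_iff_ite]
  constructor
  · intro h
    exact ⟨⟨by simpa using h 0 0, by simpa using h 1 1, by simpa using h 2 2⟩,
      by simpa using h 0 1, by simpa using h 0 2, by simpa using h 1 2⟩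
  · rintro ⟨⟨h1, h2, h3⟩, h4, h5, h6⟩ i j
    have h4' : inner ℝ b a = (0 : ℝ) := by rw [real_inner_comm, h4]
    have h5' : inner ℝ c a = (0 : ℝ) := by rw [real_inner_comm, h5]
    have h6' : inner ℝ c b = (0 : ℝ) := by rw [real_inner_comm, h6]
    fin_cases i <;> fin_cases j <;> first | exact h1 | exact h2 | exact h3 | assumption

/-- A square matrix with orthonormal rows has orthonormal columns. -/
theorem orthonormal_triple_iff_columns {a b c : E3} : Orthonormal ℝ ![a, b, c] ↔
    ∀ i j, a i * a j + b i * b j + c i * c j = if i = j then (1 : ℝ) else 0 := by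
  let M : Matrix (Fin 3) (Fin 3) ℝ := Matrix.of fun i j => ![a, b, c] i j
  have h1 : Orthonormal ℝ ![a, b, c] ↔ M * M.transpose = 1 := by
    rw [orthonormal_iff_ite, ← Matrix.ext_iff]
    refine forall_congr' fun i => forall_congr' fun j => ?_
    rw [Matrix.mul_apply, Fin.sum_univ_three, inner_eq_sum, Matrix.one_apply]
    rfl
  rw [h1, mul_eq_one_comm, ← Matrix.ext_iff]
  refine forall_congr' fun i => forall_congr' fun j => ?_
  rw [Matrix.mul_apply, Fin.sum_univ_three, Matrix.one_apply]
  rfl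

theorem eq_sum_of_orthonormal {a b c : E3} (h : Orthonormal ℝ ![a, b, c]) (v : E3) :
    v = (inner ℝ v a : ℝ) • a + (inner ℝ v b : ℝ) • b + (inner ℝ v c : ℝ) • c := by
  let B : OrthonormalBasis (Fin 3) ℝ E3 := OrthonormalBasis.mk h
    (by rw [← coe_basisOfOrthonormalOfCardEqFinrank h (by simp)]; exact (Module.Basis.span_eq _).ge)
  have := B.sum_repr v
  simp only [B.repr_apply_apply, Fin.sum_univ_three] at this
  simpa [B, real_inner_comm] using this.symm

/-- In the plane of parameters, the derivative is determined by the two partial derivatives. -/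
theorem fderiv_apply_eq {F : Type*} [NormedAddCommGroup F] [NormedSpace ℝ F]
    (f : ℝ × ℝ → F) (p h : ℝ × ℝ) : fderiv ℝ f p h = h.1 • pdu f p + h.2 • pdv f p := by
  have : h = h.1 • ((1, 0) : ℝ × ℝ) + h.2 • ((0, 1) : ℝ × ℝ) := by ext <;> simp
  conv_lhs => rw [this]
  simp only [map_add, map_smul, pdu, pdv]

section Rules

variable {F : Type*} [NormedAddCommGroup F] [NormedSpace ℝ F]
  {f g : ℝ × ℝ → E3} {c : ℝ × ℝ → ℝ} {k : ℝ × ℝ → F} {p : ℝ × ℝ}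

theorem pdu_inner (hf : DifferentiableAt ℝ f p) (hg : DifferentiableAt ℝ g p) :
    pdu (fun q => (inner ℝ (f q) (g q) : ℝ)) p =
      inner ℝ (f p) (pdu g p) + inner ℝ (pdu f p) (g p) :=
  fderiv_inner_apply ℝ hf hg _

theorem pdv_inner (hf : DifferentiableAt ℝ f p) (hg : DifferentiableAt ℝ g p) :
    pdv (fun q => (inner ℝ (f q) (g q) : ℝ)) p =
      inner ℝ (f p) (pdv g p) + inner ℝ (pdv f p) (g p) :=
  fderiv_inner_apply ℝ hf hg _

theorem pdu_smul (hc : DifferentiableAt ℝ c p) (hk : DifferentiableAt ℝ k p) :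
    pdu (fun q => c q • k q) p = c p • pdu k p + pdu c p • k p := by
  simp [pdu, fderiv_fun_smul hc hk]

theorem pdv_smul (hc : DifferentiableAt ℝ c p) (hk : DifferentiableAt ℝ k p) :
    pdv (fun q => c q • k q) p = c p • pdv k p + pdv c p • k p := by
  simp [pdv, fderiv_fun_smul hc hk]

theorem pdu_add {k' : ℝ × ℝ → F} (hk : DifferentiableAt ℝ k p) (hk' : DifferentiableAt ℝ k' p) :
    pdu (fun q => k q + k' q) p = pdu k p + pdu k' p := by
  simp [pdu, fderiv_fun_add hk hk']

theorem pdv_add {k' : ℝ × ℝ → F} (hk : DifferentiableAt ℝ k p) (hk' : DifferentiableAt ℝ k' p) :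
    pdv (fun q => k q + k' q) p = pdv k p + pdv k' p := by
  simp [pdv, fderiv_fun_add hk hk']

theorem pdu_clm (T : E3 →L[ℝ] E3) (hf : DifferentiableAt ℝ f p) :
    pdu (fun q => T (f q)) p = T (pdu f p) := by
  have h : fderiv ℝ (fun q => T (f q)) p = T.comp (fderiv ℝ f p) :=
    (T.hasFDerivAt.comp p hf.hasFDerivAt).fderiv
  rw [pdu, h]
  rfl

theorem pdv_clm (T : E3 →L[ℝ] E3) (hf : DifferentiableAt ℝ f p) :
    pdv (fun q => T (f q)) p = T (pdv f p) := by
  have h : fderiv ℝ (fun q => T (f q)) p = T.comp (fderiv ℝ f p) :=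
    (T.hasFDerivAt.comp p hf.hasFDerivAt).fderiv
  rw [pdv, h]
  rfl

theorem pdu_congr {D : Set (ℝ × ℝ)} (hD : IsOpen D) (hp : p ∈ D) {k' : ℝ × ℝ → F}
    (h : EqOn k k' D) : pdu k p = pdu k' p := by
  rw [pdu, pdu, (h.eventuallyEq_of_mem (hD.mem_nhds hp)).fderiv_eq]

theorem pdv_congr {D : Set (ℝ × ℝ)} (hD : IsOpen D) (hp : p ∈ D) {k' : ℝ × ℝ → F}
    (h : EqOn k k' D) : pdv k p = pdv k' p := by
  rw [pdv, pdv, (h.eventuallyEq_of_mem (hD.mem_nhds hp)).fderiv_eq]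

end Rules

theorem eqOn_of_partials_eq {F : Type*} [NormedAddCommGroup F] [NormedSpace ℝ F]
    {D : Set (ℝ × ℝ)} (hD : IsOpen D) (hc : IsPreconnected D) {f g : ℝ × ℝ → F}
    (hf : ∀ p ∈ D, DifferentiableAt ℝ f p) (hg : ∀ p ∈ D, DifferentiableAt ℝ g p)
    (hu : ∀ p ∈ D, pdu f p = pdu g p) (hv : ∀ p ∈ D, pdv f p = pdv g p)
    {p₀ : ℝ × ℝ} (hp₀ : p₀ ∈ D) (h0 : f p₀ = g p₀) : EqOn f g D :=
  hD.eqOn_of_fderiv_eq hc (fun p hp => (hf p hp).differentiableWithinAt)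
    (fun p hp => (hg p hp).differentiableWithinAt)
    (fun p hp => ContinuousLinearMap.ext fun h => by rw [fderiv_apply_eq, fderiv_apply_eq, hu p hp, hv p hp]) hp₀ h0

/-- The derivation equations of a moving frame `X, Y, l` along the principal lines, with connection
form `a₁ du + a₂ dv`, and with `b du`, `d dv` as the normal parts of `dX`, `dY`. -/
structure FrameEquations (D : Set (ℝ × ℝ)) (a₁ a₂ b d : ℝ × ℝ → ℝ) (X Y l : ℝ × ℝ → E3) :
    Prop where
  diff_X : ∀ p ∈ D, DifferentiableAt ℝ X p
  diff_Y : ∀ p ∈ D, DifferentiableAt ℝ Y p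
  diff_l : ∀ p ∈ D, DifferentiableAt ℝ l p
  pdu_X : ∀ p ∈ D, pdu X p = a₁ p • Y p + b p • l p
  pdv_X : ∀ p ∈ D, pdv X p = a₂ p • Y p
  pdu_Y : ∀ p ∈ D, pdu Y p = -a₁ p • X p
  pdv_Y : ∀ p ∈ D, pdv Y p = -a₂ p • X p + d p • l p
  pdu_l : ∀ p ∈ D, pdu l p = -b p • X p
  pdv_l : ∀ p ∈ D, pdv l p = -d p • Y p

/-! ### Rigidity of solutions of the frame equations -/

namespace FrameEquations

variable {D : Set (ℝ × ℝ)} {a₁ a₂ b d : ℝ × ℝ → ℝ} {X Y l X' Y' l' : ℝ × ℝ → E3}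

/-- The connection matrix is skew, so two solutions have constant mutual products. -/
theorem sum_inner_eq (h : FrameEquations D a₁ a₂ b d X Y l)
    (h' : FrameEquations D a₁ a₂ b d X' Y' l') (hD : IsOpen D) (hc : IsPreconnected D)
    {p₀ p : ℝ × ℝ} (hp₀ : p₀ ∈ D) (hp : p ∈ D) :
    (inner ℝ (X p) (X' p) + inner ℝ (Y p) (Y' p) + inner ℝ (l p) (l' p) : ℝ) =
      inner ℝ (X p₀) (X' p₀) + inner ℝ (Y p₀) (Y' p₀) + inner ℝ (l p₀) (l' p₀) := by
  have hI : ∀ {f g : ℝ × ℝ → E3} {p : ℝ × ℝ}, DifferentiableAt ℝ f p → DifferentiableAt ℝ g p →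
      DifferentiableAt ℝ (fun q => (inner ℝ (f q) (g q) : ℝ)) p := fun hf hg => hf.inner ℝ hg
  refine eqOn_of_partials_eq hD hc (f := fun q =>
      (inner ℝ (X q) (X' q) + inner ℝ (Y q) (Y' q) + inner ℝ (l q) (l' q) : ℝ))
    (g := fun _ => inner ℝ (X p₀) (X' p₀) + inner ℝ (Y p₀) (Y' p₀) + inner ℝ (l p₀) (l' p₀))
    (fun p hp => ((hI (h.diff_X p hp) (h'.diff_X p hp)).add
      (hI (h.diff_Y p hp) (h'.diff_Y p hp))).add (hI (h.diff_l p hp) (h'.diff_l p hp)))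
    (fun p _ => differentiableAt_const _) (fun p hp => ?_)
    (fun p hp => ?_) hp₀ rfl hp
  · have h1 := hI (h.diff_X p hp) (h'.diff_X p hp)
    have h2 := hI (h.diff_Y p hp) (h'.diff_Y p hp)
    have h3 := hI (h.diff_l p hp) (h'.diff_l p hp)
    rw [pdu_add (by exact h1.add h2) h3, pdu_add h1 h2,
      pdu_inner (h.diff_X p hp) (h'.diff_X p hp), pdu_inner (h.diff_Y p hp) (h'.diff_Y p hp),
      pdu_inner (h.diff_l p hp) (h'.diff_l p hp), h.pdu_X p hp, h.pdu_Y p hp, h.pdu_l p hp,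
      h'.pdu_X p hp, h'.pdu_Y p hp, h'.pdu_l p hp]
    simp only [inner_add_left, inner_add_right, real_inner_smul_left, real_inner_smul_right]
    simp [pdu]
    ring
  · have h1 := hI (h.diff_X p hp) (h'.diff_X p hp)
    have h2 := hI (h.diff_Y p hp) (h'.diff_Y p hp)
    have h3 := hI (h.diff_l p hp) (h'.diff_l p hp)
    rw [pdv_add (by exact h1.add h2) h3, pdv_add h1 h2,
      pdv_inner (h.diff_X p hp) (h'.diff_X p hp), pdv_inner (h.diff_Y p hp) (h'.diff_Y p hp),
      pdv_inner (h.diff_l p hp) (h'.diff_l p hp), h.pdv_X p hp, h.pdv_Y p hp, h.pdv_l p hp,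
      h'.pdv_X p hp, h'.pdv_Y p hp, h'.pdv_l p hp]
    simp only [inner_add_left, inner_add_right, real_inner_smul_left, real_inner_smul_right]
    simp [pdv]
    ring

/-- The conserved sum of inner products is 3 at p₀. Each summand is at most 1 by Cauchy–Schwarz, so
each equals 1, and unit vectors with inner product 1 coincide. -/
theorem eq_of_orthonormal (h : FrameEquations D a₁ a₂ b d X Y l)
    (h' : FrameEquations D a₁ a₂ b d X' Y' l') (hD : IsOpen D) (hc : IsPreconnected D)
    (ho : ∀ p ∈ D, Orthonormal ℝ ![X p, Y p, l p])
    (ho' : ∀ p ∈ D, Orthonormal ℝ ![X' p, Y' p, l' p]) {p₀ : ℝ × ℝ} (hp₀ : p₀ ∈ D)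
    (hX : X p₀ = X' p₀) (hY : Y p₀ = Y' p₀) (hl : l p₀ = l' p₀) {p : ℝ × ℝ} (hp : p ∈ D) :
    X p = X' p ∧ Y p = Y' p ∧ l p = l' p := by
  have hs := h.sum_inner_eq h' hD hc hp₀ hp
  obtain ⟨⟨i1, i2, i3⟩, -⟩ := orthonormal_triple_iff.1 (ho' p₀ hp₀)
  rw [hX, hY, hl, i1, i2, i3] at hs
  have n0 : ‖X p‖ = 1 := (ho p hp).1 0
  have n1 : ‖Y p‖ = 1 := (ho p hp).1 1
  have n2 : ‖l p‖ = 1 := (ho p hp).1 2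
  have m0 : ‖X' p‖ = 1 := (ho' p hp).1 0
  have m1 : ‖Y' p‖ = 1 := (ho' p hp).1 1
  have m2 : ‖l' p‖ = 1 := (ho' p hp).1 2
  have b0 := real_inner_le_norm (X p) (X' p)
  have b1 := real_inner_le_norm (Y p) (Y' p)
  have b2 := real_inner_le_norm (l p) (l' p)
  rw [n0, m0] at b0
  rw [n1, m1] at b1
  rw [n2, m2] at b2
  exact ⟨(inner_eq_one_iff_of_norm_eq_one (𝕜 := ℝ) n0 m0).1 (by linarith),
    (inner_eq_one_iff_of_norm_eq_one (𝕜 := ℝ) n1 m1).1 (by linarith),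
    (inner_eq_one_iff_of_norm_eq_one (𝕜 := ℝ) n2 m2).1 (by linarith)⟩

/-- The scalar coefficients commute with a constant linear map. This supplies the second solution
used to conserve orthonormality. -/
theorem map (h : FrameEquations D a₁ a₂ b d X Y l) (T : E3 →L[ℝ] E3) :
    FrameEquations D a₁ a₂ b d (fun q => T (X q)) (fun q => T (Y q)) (fun q => T (l q)) where
  diff_X p hp := T.differentiableAt.comp p (h.diff_X p hp)
  diff_Y p hp := T.differentiableAt.comp p (h.diff_Y p hp)
  diff_l p hp := T.differentiableAt.comp p (h.diff_l p hp)
  pdu_X p hp := by simp only [pdu_clm T (h.diff_X p hp), h.pdu_X p hp, map_add, map_smul]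
  pdv_X p hp := by simp only [pdv_clm T (h.diff_X p hp), h.pdv_X p hp, map_smul]
  pdu_Y p hp := by simp only [pdu_clm T (h.diff_Y p hp), h.pdu_Y p hp, map_smul]
  pdv_Y p hp := by simp only [pdv_clm T (h.diff_Y p hp), h.pdv_Y p hp, map_add, map_smul]
  pdu_l p hp := by simp only [pdu_clm T (h.diff_l p hp), h.pdu_l p hp, map_smul]
  pdv_l p hp := by simp only [pdv_clm T (h.diff_l p hp), h.pdv_l p hp, map_smul]

/-- Pairing the frame with its image under v ↦ vᵢ eⱼ turns the conserved sum into XᵢXⱼ + YᵢYⱼ +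
lᵢlⱼ. Thus orthonormality of the columns of the frame matrix propagates, and this is equivalent to
orthonormality of its rows. -/
theorem orthonormal (h : FrameEquations D a₁ a₂ b d X Y l) (hD : IsOpen D)
    (hc : IsPreconnected D) {p₀ : ℝ × ℝ} (hp₀ : p₀ ∈ D)
    (h0 : Orthonormal ℝ ![X p₀, Y p₀, l p₀]) {p : ℝ × ℝ} (hp : p ∈ D) :
    Orthonormal ℝ ![X p, Y p, l p] := by
  rw [orthonormal_triple_iff_columns] at h0 ⊢
  intro i j
  rw [← h0 i j]
  have := h.sum_inner_eq (h.map ((EuclideanSpace.proj i : E3 →L[ℝ] ℝ).smulRight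
    (EuclideanSpace.single j (1 : ℝ)))) hD hc hp₀ hp
  simpa [real_inner_smul_right, EuclideanSpace.inner_single_right, mul_comm] using this

/-- In an orthonormal frame X × Y is ±l. The sign is continuous, hence constant on a connected set,
and it is +1 at p₀. -/
theorem cross_eq (h : FrameEquations D a₁ a₂ b d X Y l) (hD : IsOpen D)
    (hc : IsPreconnected D) {p₀ : ℝ × ℝ} (hp₀ : p₀ ∈ D)
    (h0 : Orthonormal ℝ ![X p₀, Y p₀, l p₀]) (hcr : cross (X p₀) (Y p₀) = l p₀)
    {p : ℝ × ℝ} (hp : p ∈ D) : cross (X p) (Y p) = l p := by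
  have ho : ∀ q ∈ D, Orthonormal ℝ ![X q, Y q, l q] := fun q hq => h.orthonormal hD hc hp₀ h0 hq
  have hexp : ∀ q ∈ D, cross (X q) (Y q) = (inner ℝ (cross (X q) (Y q)) (l q) : ℝ) • l q := by
    intro q hq
    have := eq_sum_of_orthonormal (ho q hq) (cross (X q) (Y q))
    rwa [inner_cross_left, inner_cross_right, zero_smul, zero_smul, zero_add, zero_add] at this
  have hcont : ContinuousOn (fun q => (inner ℝ (cross (X q) (Y q)) (l q) : ℝ)) D := fun q hq =>
    ((differentiableAt_cross (h.diff_X q hq) (h.diff_Y q hq)).inner ℝ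
      (h.diff_l q hq)).continuousAt.continuousWithinAt
  have hsq : EqOn ((fun q => (inner ℝ (cross (X q) (Y q)) (l q) : ℝ)) ^ 2)
      ((fun _ => (1 : ℝ)) ^ 2) D := by
    intro q hq
    obtain ⟨⟨i1, i2, i3⟩, i4, -⟩ := orthonormal_triple_iff.1 (ho q hq)
    have := inner_cross_self (X q) (Y q)
    rw [hexp q hq, i1, i2, i4, inner_smul_left, inner_smul_right, i3] at this
    simpa [sq] using this
  have hone : (inner ℝ (cross (X p) (Y p)) (l p) : ℝ) = 1 :=
    hc.eq_of_sq_eq hcont continuousOn_const hsq (by simp) hp₀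
      (by rw [hcr]; exact (orthonormal_triple_iff.1 h0).1.2.2) hp
  rw [hexp p hp, hone, one_smul]

end FrameEquations

end SurfaceTheory

/-! ### The surface and its frame as one flat linear system -/

namespace SurfaceTheory

/-- The action of the coefficients of a moving frame on a position with a frame. -/
noncomputable def frameAction :
    (ℝ × ℝ × ℝ × ℝ × ℝ) →L[ℝ] (E3 × E3 × E3 × E3) →L[ℝ] E3 × E3 × E3 × E3 :=
  LinearMap.toContinuousBilinearMap <| LinearMap.mk₂ ℝ
    (fun g w => (g.1 • w.2.1 + g.2.1 • w.2.2.1, g.2.2.1 • w.2.2.1 + g.2.2.2.1 • w.2.2.2,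
      -g.2.2.1 • w.2.1 + g.2.2.2.2 • w.2.2.2, -g.2.2.2.1 • w.2.1 + -g.2.2.2.2 • w.2.2.1))
    (fun _ _ _ => by ext1 <;> [skip; ext1 <;> [skip; ext1]] <;> simp <;> module)
    (fun _ _ _ => by ext1 <;> [skip; ext1 <;> [skip; ext1]] <;> simp <;> module)
    (fun _ _ _ => by ext1 <;> [skip; ext1 <;> [skip; ext1]] <;> simp <;> module)
    (fun _ _ _ => by ext1 <;> [skip; ext1 <;> [skip; ext1]] <;> simp <;> module)

theorem frameAction_apply (g : ℝ × ℝ × ℝ × ℝ × ℝ) (w : E3 × E3 × E3 × E3) :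
    frameAction g w =
      (g.1 • w.2.1 + g.2.1 • w.2.2.1, g.2.2.1 • w.2.2.1 + g.2.2.2.1 • w.2.2.2,
      -g.2.2.1 • w.2.1 + g.2.2.2.2 • w.2.2.2, -g.2.2.2.1 • w.2.1 + -g.2.2.2.2 • w.2.2.1) :=
  rfl

/-- The coefficient form `(s du, s dv, a₁ du + a₂ dv, b du, d dv)`. -/
noncomputable def frameForm (s a₁ a₂ b d : ℝ × ℝ → ℝ) (p : ℝ × ℝ) :
    ℝ × ℝ →L[ℝ] ℝ × ℝ × ℝ × ℝ × ℝ :=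
  (s p • ContinuousLinearMap.fst ℝ ℝ ℝ).prod
    ((s p • ContinuousLinearMap.snd ℝ ℝ ℝ).prod
      ((a₁ p • ContinuousLinearMap.fst ℝ ℝ ℝ + a₂ p • ContinuousLinearMap.snd ℝ ℝ ℝ).prod
        ((b p • ContinuousLinearMap.fst ℝ ℝ ℝ).prod (d p • ContinuousLinearMap.snd ℝ ℝ ℝ))))

theorem frameForm_apply (s a₁ a₂ b d : ℝ × ℝ → ℝ) (p h : ℝ × ℝ) : frameForm s a₁ a₂ b d p h =
    (s p * h.1, s p * h.2, a₁ p * h.1 + a₂ p * h.2, b p * h.1, d p * h.2) := rfl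

theorem contDiffOn_frameForm {s a₁ a₂ b d : ℝ × ℝ → ℝ} {D : Set (ℝ × ℝ)} {m : WithTop ℕ∞}
    (hs : ContDiffOn ℝ m s D) (ha₁ : ContDiffOn ℝ m a₁ D) (ha₂ : ContDiffOn ℝ m a₂ D)
    (hb : ContDiffOn ℝ m b D) (hd : ContDiffOn ℝ m d D) :
    ContDiffOn ℝ m (frameForm s a₁ a₂ b d) D := by
  rw [contDiffOn_clm_apply]
  intro h
  simp only [frameForm_apply]
  fun_prop

theorem fderiv_frameForm_apply {s a₁ a₂ b d : ℝ × ℝ → ℝ} {p : ℝ × ℝ}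
    (hA : DifferentiableAt ℝ (frameForm s a₁ a₂ b d) p)
    (hs : DifferentiableAt ℝ s p) (ha₁ : DifferentiableAt ℝ a₁ p)
    (ha₂ : DifferentiableAt ℝ a₂ p) (hb : DifferentiableAt ℝ b p)
    (hd : DifferentiableAt ℝ d p) (h k : ℝ × ℝ) :
    fderiv ℝ (frameForm s a₁ a₂ b d) p h k =
      (fderiv ℝ s p h * k.1, fderiv ℝ s p h * k.2,
        fderiv ℝ a₁ p h * k.1 + fderiv ℝ a₂ p h * k.2, fderiv ℝ b p h * k.1,
        fderiv ℝ d p h * k.2) := by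
  have h1 := hA.hasFDerivAt.clm_apply (hasFDerivAt_const k p)
  have h2 := ((hs.hasFDerivAt.mul_const k.1).prodMk ((hs.hasFDerivAt.mul_const k.2).prodMk
    (((ha₁.hasFDerivAt.mul_const k.1).add (ha₂.hasFDerivAt.mul_const k.2)).prodMk
      ((hb.hasFDerivAt.mul_const k.1).prodMk (hd.hasFDerivAt.mul_const k.2)))))
  have h3 := congrArg (fun T => T h) (h1.unique h2)
  simpa [mul_comm] using h3

set_option maxHeartbeats 1000000 in
/-- Local existence of a surface with a moving frame, from the Gauss and Codazzi equations. -/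
theorem exists_surface_frame {s a₁ a₂ b d : ℝ × ℝ → ℝ} {D : Set (ℝ × ℝ)} (hD : IsOpen D)
    {p₀ : ℝ × ℝ} (hp₀ : p₀ ∈ D) {m : ℕ∞} (hm : 1 ≤ m)
    (hs : ContDiffOn ℝ m s D) (ha₁ : ContDiffOn ℝ m a₁ D) (ha₂ : ContDiffOn ℝ m a₂ D)
    (hb : ContDiffOn ℝ m b D) (hd : ContDiffOn ℝ m d D)
    (pdu_s : ∀ p ∈ D, pdu s p = s p * a₂ p) (pdv_s : ∀ p ∈ D, pdv s p = -(s p * a₁ p))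
    (gauss : ∀ p ∈ D, pdu a₂ p - pdv a₁ p = -(b p * d p))
    (codazzi_b : ∀ p ∈ D, pdv b p = -(a₁ p * d p))
    (codazzi_d : ∀ p ∈ D, pdu d p = a₂ p * b p) (x₀ X₀ Y₀ l₀ : E3) :
    ∃ r > 0, Metric.ball p₀ r ⊆ D ∧ ∃ x X Y l : ℝ × ℝ → E3,
      FrameEquations (Metric.ball p₀ r) a₁ a₂ b d X Y l ∧
      (∀ p ∈ Metric.ball p₀ r, DifferentiableAt ℝ x p) ∧
      (∀ p ∈ Metric.ball p₀ r, pdu x p = s p • X p) ∧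
      (∀ p ∈ Metric.ball p₀ r, pdv x p = s p • Y p) ∧
      ContDiffOn ℝ ((m : WithTop ℕ∞) + 1) X (Metric.ball p₀ r) ∧
      ContDiffOn ℝ ((m : WithTop ℕ∞) + 1) Y (Metric.ball p₀ r) ∧
      x p₀ = x₀ ∧ X p₀ = X₀ ∧ Y p₀ = Y₀ ∧ l p₀ = l₀ := by
  have hm' : (1 : WithTop ℕ∞) ≤ m := by exact_mod_cast hm
  have hm0 : (m : WithTop ℕ∞) ≠ 0 := fun h => by simp [h] at hm'
  have hA := contDiffOn_frameForm hs ha₁ ha₂ hb hd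
  have diff : ∀ {f : ℝ × ℝ → ℝ}, ContDiffOn ℝ m f D → ∀ p ∈ D, DifferentiableAt ℝ f p :=
    fun hf p hp => (hf.contDiffAt (hD.mem_nhds hp)).differentiableAt hm0
  have hAd : ∀ p ∈ D, DifferentiableAt ℝ (frameForm s a₁ a₂ b d) p :=
    fun p hp => (hA.contDiffAt (hD.mem_nhds hp)).differentiableAt hm0
  obtain ⟨r, hr, hrD, W, hW0, hW⟩ := TotalDifferential.exists_solution frameAction hD hp₀
    (fun p hp => (hAd p hp).hasFDerivAt) (hA.continuousOn_fderiv_of_isOpen hD hm')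
    (fun p hp h k w => by
      rw [fderiv_frameForm_apply (hAd p hp) (diff hs p hp) (diff ha₁ p hp) (diff ha₂ p hp)
        (diff hb p hp) (diff hd p hp), fderiv_frameForm_apply (hAd p hp) (diff hs p hp)
        (diff ha₁ p hp) (diff ha₂ p hp) (diff hb p hp) (diff hd p hp)]
      -- Flatness by components: the position needs the two equations for s; X and Y need Gauss
      -- (tangential part) and one Codazzi equation each (normal part); l needs both Codazzi
      -- equations.
      have e1 := gauss p hp
      have e2 := pdu_s p hp
      have e3 := pdv_s p hp
      have e4 := codazzi_b p hp
      have e5 := codazzi_d p hp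
      simp only [fderiv_apply_eq _ p h, fderiv_apply_eq _ p k, frameAction_apply,
        frameForm_apply, smul_eq_mul, Prod.mk_add_mk, Prod.mk.injEq]
      rw [e2, e3, e4, e5, show pdu a₂ p = pdv a₁ p - b p * d p by linarith]
      refine ⟨?_, ?_, ?_, ?_⟩ <;> module) (x₀, X₀, Y₀, l₀)
  have hWc := TotalDifferential.contDiffOn_solution frameAction Metric.isOpen_ball hW
    (hA.mono hrD)
  have h1 : ∀ p ∈ Metric.ball p₀ r, HasFDerivAt (fun q => (W q).1) _ p :=
    fun p hp => (hW p hp).fst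
  have h2 : ∀ p ∈ Metric.ball p₀ r, HasFDerivAt (fun q => (W q).2.1) _ p :=
    fun p hp => (hW p hp).snd.fst
  have h3 : ∀ p ∈ Metric.ball p₀ r, HasFDerivAt (fun q => (W q).2.2.1) _ p :=
    fun p hp => (hW p hp).snd.snd.fst
  have h4 : ∀ p ∈ Metric.ball p₀ r, HasFDerivAt (fun q => (W q).2.2.2) _ p :=
    fun p hp => (hW p hp).snd.snd.snd
  refine ⟨r, hr, hrD, fun p => (W p).1, fun p => (W p).2.1, fun p => (W p).2.2.1,
    fun p => (W p).2.2.2, ⟨fun p hp => (h2 p hp).differentiableAt,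
      fun p hp => (h3 p hp).differentiableAt, fun p hp => (h4 p hp).differentiableAt,
      ?_, ?_, ?_, ?_, ?_, ?_⟩, fun p hp => (h1 p hp).differentiableAt, ?_, ?_,
    hWc.snd.fst, hWc.snd.snd.fst, by simp [hW0], by simp [hW0], by simp [hW0], by simp [hW0]⟩
  all_goals
    intro p hp
    simp only [pdu, pdv, (h1 p hp).fderiv, (h2 p hp).fderiv, (h3 p hp).fderiv, (h4 p hp).fderiv]
    simp [frameAction_apply, frameForm_apply]

end SurfaceTheory

/-! ### Coefficients of the frame system in terms of ν -/

namespace SurfaceTheory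

section Calculus

variable {F : Type*} [NormedAddCommGroup F] [NormedSpace ℝ F] {D : Set (ℝ × ℝ)}

theorem contDiffOn_pdu {f : ℝ × ℝ → F} (hD : IsOpen D) {m : WithTop ℕ∞}
    (hf : ContDiffOn ℝ (m + 1) f D) : ContDiffOn ℝ m (pdu f) D :=
  ((contDiffOn_succ_iff_fderiv_of_isOpen hD).1 hf).2.2.clm_apply contDiffOn_const

theorem contDiffOn_pdv {f : ℝ × ℝ → F} (hD : IsOpen D) {m : WithTop ℕ∞}
    (hf : ContDiffOn ℝ (m + 1) f D) : ContDiffOn ℝ m (pdv f) D :=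
  ((contDiffOn_succ_iff_fderiv_of_isOpen hD).1 hf).2.2.clm_apply contDiffOn_const

/-- A map with partial derivatives of class `C^m` is of class `C^(m+1)`. -/
theorem contDiffOn_succ_of_partials {f : ℝ × ℝ → F} (hD : IsOpen D) {m : ℕ∞}
    (hd : ∀ p ∈ D, DifferentiableAt ℝ f p) (hu : ContDiffOn ℝ m (pdu f) D)
    (hv : ContDiffOn ℝ m (pdv f) D) : ContDiffOn ℝ ((m : WithTop ℕ∞) + 1) f D := by
  rw [contDiffOn_succ_iff_fderiv_of_isOpen hD]
  refine ⟨fun p hp => (hd p hp).differentiableWithinAt, by simp, contDiffOn_clm_apply.2 fun h => ?_⟩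
  simp only [fderiv_apply_eq]
  fun_prop

theorem pdu_comp {ν : ℝ × ℝ → ℝ} {g : ℝ → ℝ} {g' : ℝ} {p : ℝ × ℝ} (hg : HasDerivAt g g' (ν p))
    (hν : DifferentiableAt ℝ ν p) : pdu (fun q => g (ν q)) p = g' * pdu ν p := by
  have h : fderiv ℝ (fun q => g (ν q)) p = g' • fderiv ℝ ν p :=
    (hg.comp_hasFDerivAt p hν.hasFDerivAt).fderiv
  rw [pdu, h]
  rfl

theorem pdv_comp {ν : ℝ × ℝ → ℝ} {g : ℝ → ℝ} {g' : ℝ} {p : ℝ × ℝ} (hg : HasDerivAt g g' (ν p))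
    (hν : DifferentiableAt ℝ ν p) : pdv (fun q => g (ν q)) p = g' * pdv ν p := by
  have h : fderiv ℝ (fun q => g (ν q)) p = g' • fderiv ℝ ν p :=
    (hg.comp_hasFDerivAt p hν.hasFDerivAt).fderiv
  rw [pdv, h]
  rfl

theorem pdu_div_const {f : ℝ × ℝ → ℝ} {p : ℝ × ℝ} (hf : DifferentiableAt ℝ f p) (c : ℝ) :
    pdu (fun q => f q / c) p = pdu f p / c := by
  rw [pdu_comp (g := fun t => t / c) ((hasDerivAt_id _).div_const c) hf]; ring

theorem pdv_div_const {f : ℝ × ℝ → ℝ} {p : ℝ × ℝ} (hf : DifferentiableAt ℝ f p) (c : ℝ) :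
    pdv (fun q => f q / c) p = pdv f p / c := by
  rw [pdv_comp (g := fun t => t / c) ((hasDerivAt_id _).div_const c) hf]; ring

end Calculus

/-- The conformal factor `1 / √(2 t)` of canonical principal parameters. -/
noncomputable def conformalFactor (t : ℝ) : ℝ := (Real.sqrt (2 * t))⁻¹

theorem conformalFactor_pos {t : ℝ} (ht : 0 < t) : 0 < conformalFactor t := by
  unfold conformalFactor; positivity

theorem conformalFactor_mul_self {t : ℝ} (ht : 0 < t) :
    conformalFactor t * conformalFactor t = (2 * t)⁻¹ := by
  unfold conformalFactor
  rw [← mul_inv, Real.mul_self_sqrt (by positivity)]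

theorem hasDerivAt_sqrt_two_mul {t : ℝ} (ht : 0 < t) :
    HasDerivAt (fun t => Real.sqrt (2 * t)) (conformalFactor t) t := by
  have h := ((hasDerivAt_id t).const_mul 2).sqrt (by simp [ht.ne'])
  refine h.congr_deriv ?_
  unfold conformalFactor
  simp only [id]
  field_simp

theorem hasDerivAt_conformalFactor {t : ℝ} (ht : 0 < t) :
    HasDerivAt conformalFactor (-(conformalFactor t / (2 * t))) t := by
  have h0 : 0 < Real.sqrt (2 * t) := by positivity
  refine ((hasDerivAt_sqrt_two_mul ht).inv h0.ne').congr_deriv ?_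
  unfold conformalFactor
  rw [Real.sq_sqrt (by positivity)]
  ring

/-- The `du`-part of the connection form of a surface of constant mean curvature in canonical
principal parameters. -/
noncomputable def coeffA₁ (ν : ℝ × ℝ → ℝ) (p : ℝ × ℝ) : ℝ := pdv (fun q => Real.log (ν q)) p / 2

/-- The `dv`-part of the connection form of a surface of constant mean curvature in canonical
principal parameters. -/
noncomputable def coeffA₂ (ν : ℝ × ℝ → ℝ) (p : ℝ × ℝ) : ℝ := pdu (fun q => Real.log (ν q)) p / (-2)

/-- The normal part of `X_u` for a surface of constant mean curvature `H` in canonical principal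
parameters. -/
noncomputable def coeffB (H : ℝ) (ν : ℝ × ℝ → ℝ) (p : ℝ × ℝ) : ℝ :=
  (H + ν p) * conformalFactor (ν p)

/-- The normal part of `Y_v` for a surface of constant mean curvature `H` in canonical principal
parameters. -/
noncomputable def coeffD (H : ℝ) (ν : ℝ × ℝ → ℝ) (p : ℝ × ℝ) : ℝ :=
  (H - ν p) * conformalFactor (ν p)

section Coefficients

variable {ν : ℝ × ℝ → ℝ} {p : ℝ × ℝ} (H : ℝ)

theorem coeffA₁_eq (hν : DifferentiableAt ℝ ν p) (hpos : 0 < ν p) :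
    coeffA₁ ν p = pdv ν p / (2 * ν p) := by
  rw [coeffA₁, pdv_comp (Real.hasDerivAt_log hpos.ne') hν]; field_simp

theorem coeffA₂_eq (hν : DifferentiableAt ℝ ν p) (hpos : 0 < ν p) :
    coeffA₂ ν p = -(pdu ν p / (2 * ν p)) := by
  rw [coeffA₂, pdu_comp (Real.hasDerivAt_log hpos.ne') hν]; field_simp

theorem pdu_conformalFactor (hν : DifferentiableAt ℝ ν p) (hpos : 0 < ν p) :
    pdu (fun q => conformalFactor (ν q)) p = conformalFactor (ν p) * coeffA₂ ν p := by
  rw [pdu_comp (hasDerivAt_conformalFactor hpos) hν, coeffA₂_eq hν hpos]; ring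

theorem pdv_conformalFactor (hν : DifferentiableAt ℝ ν p) (hpos : 0 < ν p) :
    pdv (fun q => conformalFactor (ν q)) p = -(conformalFactor (ν p) * coeffA₁ ν p) := by
  rw [pdv_comp (hasDerivAt_conformalFactor hpos) hν, coeffA₁_eq hν hpos]; ring

/-- A Codazzi equation, valid for every ν because H is constant: as functions of t = ν, the
coefficients satisfy b' = -d/(2t), and symmetrically d' = -b/(2t) gives `pdu_coeffD`. -/
theorem pdv_coeffB (hν : DifferentiableAt ℝ ν p) (hpos : 0 < ν p) :
    pdv (coeffB H ν) p = -(coeffA₁ ν p * coeffD H ν p) := by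
  have h := pdv_comp (ν := ν) (p := p) (g := fun t => (H + t) * conformalFactor t)
    (((hasDerivAt_id (ν p)).const_add H).mul (hasDerivAt_conformalFactor hpos)) hν
  refine (show pdv (coeffB H ν) p = _ from h).trans ?_
  rw [coeffA₁_eq hν hpos, coeffD]
  simp only [id]
  field_simp
  ring

theorem pdu_coeffD (hν : DifferentiableAt ℝ ν p) (hpos : 0 < ν p) :
    pdu (coeffD H ν) p = coeffA₂ ν p * coeffB H ν p := by
  have h := pdu_comp (ν := ν) (p := p) (g := fun t => (H - t) * conformalFactor t)
    (((hasDerivAt_id (ν p)).const_sub H).mul (hasDerivAt_conformalFactor hpos)) hν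
  refine (show pdu (coeffD H ν) p = _ from h).trans ?_
  rw [coeffA₂_eq hν hpos, coeffB]
  simp only [id]
  field_simp
  ring

/-- This product is the curvature term of the Gauss equation: half the right-hand side of the
equation for Δ ln ν. -/
theorem coeffB_mul_coeffD (hpos : 0 < ν p) :
    coeffB H ν p * coeffD H ν p = (H ^ 2 - ν p ^ 2) / ν p / 2 := by
  have : coeffB H ν p * coeffD H ν p =
      (H + ν p) * (H - ν p) * (conformalFactor (ν p) * conformalFactor (ν p)) := by
    rw [coeffB, coeffD]; ring
  rw [this, conformalFactor_mul_self hpos]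
  field_simp
  ring

end Coefficients

/-! ### Invariants of a framed surface -/

section Surface

variable {H : ℝ} {D : Set (ℝ × ℝ)} {ν : ℝ × ℝ → ℝ} {x X Y l : ℝ × ℝ → E3}

/-- A surface in conformal parameters whose unit frame solves the derivation equations of
canonical principal parameters. -/
structure IsFramedSurface (H : ℝ) (D : Set (ℝ × ℝ)) (ν : ℝ × ℝ → ℝ) (x X Y l : ℝ × ℝ → E3) :
    Prop where
  isOpen : IsOpen D
  diff_ν : ∀ p ∈ D, DifferentiableAt ℝ ν p
  pos : ∀ p ∈ D, 0 < ν p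
  frame : FrameEquations D (coeffA₁ ν) (coeffA₂ ν) (coeffB H ν) (coeffD H ν) X Y l
  orthonormal : ∀ p ∈ D, Orthonormal ℝ ![X p, Y p, l p]
  cross_eq : ∀ p ∈ D, cross (X p) (Y p) = l p
  pdu_eq : ∀ p ∈ D, pdu x p = conformalFactor (ν p) • X p
  pdv_eq : ∀ p ∈ D, pdv x p = conformalFactor (ν p) • Y p

namespace IsFramedSurface

variable (h : IsFramedSurface H D ν x X Y l) {p : ℝ × ℝ} (hp : p ∈ D)
include h hp

theorem coeffE_eq : coeffE x p = (2 * ν p)⁻¹ := by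
  obtain ⟨⟨i1, i2, i3⟩, i4, i5, i6⟩ := orthonormal_triple_iff.1 (h.orthonormal p hp)
  rw [coeffE, h.pdu_eq p hp, real_inner_smul_left, real_inner_smul_right, i1, mul_one,
    conformalFactor_mul_self (h.pos p hp)]

theorem coeffF_eq : coeffF x p = 0 := by
  obtain ⟨⟨i1, i2, i3⟩, i4, i5, i6⟩ := orthonormal_triple_iff.1 (h.orthonormal p hp)
  rw [coeffF, h.pdu_eq p hp, h.pdv_eq p hp, real_inner_smul_left, real_inner_smul_right, i4,
    mul_zero, mul_zero]

theorem coeffG_eq : coeffG x p = (2 * ν p)⁻¹ := by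
  obtain ⟨⟨i1, i2, i3⟩, i4, i5, i6⟩ := orthonormal_triple_iff.1 (h.orthonormal p hp)
  rw [coeffG, h.pdv_eq p hp, real_inner_smul_left, real_inner_smul_right, i2, mul_one,
    conformalFactor_mul_self (h.pos p hp)]

theorem unitNormal_eq : unitNormal x p = l p := by
  have hs := conformalFactor_pos (h.pos p hp)
  have hl : ‖l p‖ = 1 := (h.orthonormal p hp).1 2
  rw [unitNormal, h.pdu_eq p hp, h.pdv_eq p hp, cross_smul_smul, h.cross_eq p hp, norm_smul, hl,
    mul_one, Real.norm_of_nonneg (by positivity), smul_smul, inv_mul_cancel₀ (by positivity),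
    one_smul]

theorem tangentX_eq : tangentX x p = X p := by
  have hs := conformalFactor_pos (h.pos p hp)
  rw [tangentX, h.coeffE_eq hp, Real.sqrt_inv, h.pdu_eq p hp, ← conformalFactor, smul_smul,
    inv_mul_cancel₀ hs.ne', one_smul]

theorem tangentY_eq : tangentY x p = Y p := by
  have hs := conformalFactor_pos (h.pos p hp)
  rw [tangentY, h.coeffG_eq hp, Real.sqrt_inv, h.pdv_eq p hp, ← conformalFactor, smul_smul,
    inv_mul_cancel₀ hs.ne', one_smul]

theorem differentiableAt_conformalFactor :
    DifferentiableAt ℝ (fun q => conformalFactor (ν q)) p :=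
  (hasDerivAt_conformalFactor (h.pos p hp)).differentiableAt.comp p (h.diff_ν p hp)

theorem coeffL_eq : coeffL x p = (H + ν p) * (2 * ν p)⁻¹ := by
  obtain ⟨⟨i1, i2, i3⟩, i4, i5, i6⟩ := orthonormal_triple_iff.1 (h.orthonormal p hp)
  rw [coeffL, h.unitNormal_eq hp, pdu_congr h.isOpen hp h.pdu_eq,
    pdu_smul (h.differentiableAt_conformalFactor hp) (h.frame.diff_X p hp), h.frame.pdu_X p hp,
    ← conformalFactor_mul_self (h.pos p hp), coeffB]
  simp only [inner_add_left, real_inner_smul_left, i3, i5, i6]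
  ring

theorem coeffM_eq : coeffM x p = 0 := by
  obtain ⟨⟨i1, i2, i3⟩, i4, i5, i6⟩ := orthonormal_triple_iff.1 (h.orthonormal p hp)
  rw [coeffM, h.unitNormal_eq hp, pdv_congr h.isOpen hp h.pdu_eq,
    pdv_smul (h.differentiableAt_conformalFactor hp) (h.frame.diff_X p hp), h.frame.pdv_X p hp]
  simp only [inner_add_left, real_inner_smul_left, i5, i6]
  ring

theorem coeffN_eq : coeffN x p = (H - ν p) * (2 * ν p)⁻¹ := by
  obtain ⟨⟨i1, i2, i3⟩, i4, i5, i6⟩ := orthonormal_triple_iff.1 (h.orthonormal p hp)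
  rw [coeffN, h.unitNormal_eq hp, pdv_congr h.isOpen hp h.pdv_eq,
    pdv_smul (h.differentiableAt_conformalFactor hp) (h.frame.diff_Y p hp), h.frame.pdv_Y p hp,
    ← conformalFactor_mul_self (h.pos p hp), coeffD]
  simp only [inner_add_left, real_inner_smul_left, i3, i5, i6]
  ring

theorem nu₁_eq : nu₁ x p = H + ν p := by
  have := h.pos p hp
  rw [nu₁, h.coeffL_eq hp, h.coeffE_eq hp]; field_simp

theorem nu₂_eq : nu₂ x p = H - ν p := by
  have := h.pos p hp
  rw [nu₂, h.coeffN_eq hp, h.coeffG_eq hp]; field_simp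

theorem halfDiff_eq : halfDiff x p = ν p := by
  rw [halfDiff, h.nu₁_eq hp, h.nu₂_eq hp]; ring

theorem meanCurvature_eq : meanCurvature x p = H := by
  have := h.pos p hp
  rw [meanCurvature, h.coeffE_eq hp, h.coeffG_eq hp, h.coeffF_eq hp, h.coeffL_eq hp,
    h.coeffN_eq hp]
  field_simp
  ring

theorem gamma₁_eq : gamma₁ x p = pdv (fun q => Real.sqrt (2 * ν q)) p := by
  have hpos := h.pos p hp
  have hd : HasDerivAt (fun t : ℝ => (2 * t)⁻¹) (-(2 * 1) / (2 * ν p) ^ 2) (ν p) :=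
    ((hasDerivAt_id (ν p)).const_mul 2).inv (by simp [hpos.ne'])
  rw [gamma₁, pdv_congr h.isOpen hp (fun q hq => h.coeffE_eq hq), h.coeffE_eq hp, h.coeffG_eq hp,
    pdv_comp hd (h.diff_ν p hp), pdv_comp (hasDerivAt_sqrt_two_mul hpos) (h.diff_ν p hp),
    Real.sqrt_inv, ← conformalFactor]
  have hs := conformalFactor_pos hpos
  have hs2 := conformalFactor_mul_self hpos
  field_simp at hs2 ⊢
  linear_combination (-pdv ν p) * hs2

theorem gamma₂_eq : gamma₂ x p = -pdu (fun q => Real.sqrt (2 * ν q)) p := by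
  have hpos := h.pos p hp
  have hd : HasDerivAt (fun t : ℝ => (2 * t)⁻¹) (-(2 * 1) / (2 * ν p) ^ 2) (ν p) :=
    ((hasDerivAt_id (ν p)).const_mul 2).inv (by simp [hpos.ne'])
  rw [gamma₂, pdu_congr h.isOpen hp (fun q hq => h.coeffG_eq hq), h.coeffE_eq hp, h.coeffG_eq hp,
    pdu_comp hd (h.diff_ν p hp), pdu_comp (hasDerivAt_sqrt_two_mul hpos) (h.diff_ν p hp),
    Real.sqrt_inv, ← conformalFactor]
  have hs := conformalFactor_pos hpos
  have hs2 := conformalFactor_mul_self hpos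
  field_simp at hs2 ⊢
  linear_combination (pdu ν p) * hs2

end IsFramedSurface

end Surface

/-! ### The functions λ, μ and the passage from frame to surface -/

theorem integral_deriv_add_div (H : ℝ) {a b : ℝ} (ha : 0 < a) (hb : 0 < b) :
    ∫ t in a..b, deriv (fun t => H + t) t / ((H + t) - (H - t)) =
      (Real.log b - Real.log a) / 2 := by
  have h : ∀ t : ℝ, deriv (fun t => H + t) t / ((H + t) - (H - t)) = 1 / 2 * t⁻¹ := by
    intro t
    have h2 : (H + t) - (H - t) = 2 * t := by ring
    rw [h2, deriv_const_add, deriv_id'', one_div_mul_eq_div, mul_comm, ← div_div, one_div]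
  simp only [h]
  rw [intervalIntegral.integral_const_mul, integral_inv_of_pos ha hb, Real.log_div hb.ne' ha.ne']
  ring

theorem integral_deriv_sub_div (H : ℝ) {a b : ℝ} (ha : 0 < a) (hb : 0 < b) :
    ∫ t in a..b, deriv (fun t => H - t) t / ((H - t) - (H + t)) =
      (Real.log b - Real.log a) / 2 := by
  rw [← integral_deriv_add_div H ha hb]
  congr 1
  ext t
  rw [deriv_const_sub, deriv_const_add, ← neg_sub (H + t) (H - t), neg_div_neg_eq]

/-- The integrand is 1/(2t), so λ is constant exactly when Eν is; `mu_eq` gives the same for Gν. -/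
theorem lam_eq {x : ℝ × ℝ → E3} {H : ℝ} {ν : ℝ × ℝ → ℝ} {t₀ : ℝ} {p : ℝ × ℝ}
    (hE : 0 < coeffE x p) (ht : 0 < t₀) (hν : 0 < ν p) :
    lam x (fun t => H + t) (fun t => H - t) ν t₀ p =
      (Real.log (coeffE x p) + Real.log (ν p) - Real.log t₀) / 2 := by
  rw [lam, integral_deriv_add_div H ht hν, Real.log_mul (by positivity) (by positivity),
    Real.log_exp, Real.log_sqrt hE.le]
  ring

theorem mu_eq {x : ℝ × ℝ → E3} {H : ℝ} {ν : ℝ × ℝ → ℝ} {t₀ : ℝ} {p : ℝ × ℝ}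
    (hG : 0 < coeffG x p) (ht : 0 < t₀) (hν : 0 < ν p) :
    mu x (fun t => H + t) (fun t => H - t) ν t₀ p =
      (Real.log (coeffG x p) + Real.log (ν p) - Real.log t₀) / 2 := by
  rw [mu, integral_deriv_sub_div H ht hν, Real.log_mul (by positivity) (by positivity),
    Real.log_exp, Real.log_sqrt hG.le]
  ring

theorem IsFramedSurface.isCMCSurface {H : ℝ} {D : Set (ℝ × ℝ)} {ν : ℝ × ℝ → ℝ}
    {x X Y l : ℝ × ℝ → E3} (h : IsFramedSurface H D ν x X Y l)
    (hne : ∀ p ∈ D, pdu ν p * pdv ν p ≠ 0) {k : WithTop ℕ∞} (hx : ContDiffOn ℝ k x D)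
    {p₀ : ℝ × ℝ} (hp₀ : p₀ ∈ D) :
    IsCMCSurface k H ν p₀ (x p₀) (X p₀) (Y p₀) (l p₀) D x where
  stronglyRegular :=
    { regular := ⟨hx, fun p hp => by
        have hpos := h.pos p hp
        have hs := conformalFactor_pos hpos
        have hF := h.coeffF_eq hp
        have hE := h.coeffE_eq hp
        have hG := h.coeffG_eq hp
        rw [coeffF] at hF
        rw [coeffE] at hE
        rw [coeffG] at hG
        rw [LinearIndependent.pair_iff]
        intro a b hab
        have e1 := congrArg (fun w : E3 => (inner ℝ w (pdu x p) : ℝ)) hab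
        have e2 := congrArg (fun w : E3 => (inner ℝ w (pdv x p) : ℝ)) hab
        simp only [inner_add_left, real_inner_smul_left, hE, hF, hG, inner_zero_left,
          real_inner_comm (pdu x p) (pdv x p), mul_zero, add_zero, zero_add] at e1 e2
        have hi : (2 * ν p)⁻¹ ≠ 0 := by positivity
        exact ⟨(mul_eq_zero.1 e1).resolve_right hi, (mul_eq_zero.1 e2).resolve_right hi⟩⟩
      principal := fun p hp => ⟨h.coeffF_eq hp, h.coeffM_eq hp⟩
      ne_zero := fun p hp => by
        have hpos := h.pos p hp
        have hs := conformalFactor_pos hpos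
        rw [h.nu₁_eq hp, h.nu₂_eq hp, h.gamma₁_eq hp, h.gamma₂_eq hp,
          pdu_comp (hasDerivAt_sqrt_two_mul hpos) (h.diff_ν p hp),
          pdv_comp (hasDerivAt_sqrt_two_mul hpos) (h.diff_ν p hp)]
        obtain ⟨n1, n2⟩ := mul_ne_zero_iff.1 (hne p hp)
        have : H + ν p - (H - ν p) ≠ 0 := by
          rw [show H + ν p - (H - ν p) = 2 * ν p by ring]; positivity
        exact mul_ne_zero (mul_ne_zero this (mul_ne_zero hs.ne' n2))
          (neg_ne_zero.2 (mul_ne_zero hs.ne' n1)) }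
  canonical :=
    { geometric :=
        { principal := fun p hp => ⟨h.coeffF_eq hp, h.coeffM_eq hp⟩
          weingarten :=
            { ordConnected := ordConnected_Ioi
              diff_f := fun t _ => by fun_prop
              diff_g := fun t _ => by fun_prop
              sub_pos := fun t ht => by
                have : 0 < t := ht
                linarith
              deriv_ne := fun t _ => by simp
              mem := fun p hp => by
                rw [h.halfDiff_eq hp]; exact h.pos p hp
              nu₁_eq := fun p hp => by rw [h.nu₁_eq hp, h.halfDiff_eq hp]
              nu₂_eq := fun p hp => by rw [h.nu₂_eq hp, h.halfDiff_eq hp]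
              partial_ne := fun p hp => by
                rw [pdu_congr h.isOpen hp fun q hq => h.halfDiff_eq hq,
                  pdv_congr h.isOpen hp fun q hq => h.halfDiff_eq hq]
                exact hne p hp }
          -- The value comes from Eν = 1/2 in `lam_eq`.
          lam_const := ⟨(-Real.log 2 - Real.log (ν p₀)) / 2, fun p hp => by
            have hpos := h.pos p hp
            have hE : 0 < coeffE x p := by rw [h.coeffE_eq hp]; positivity
            rw [lam_eq hE (by rw [h.halfDiff_eq hp₀]; exact h.pos p₀ hp₀)
              (by rwa [h.halfDiff_eq hp]), h.halfDiff_eq hp, h.halfDiff_eq hp₀, h.coeffE_eq hp,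
              Real.log_inv, Real.log_mul two_ne_zero hpos.ne']
            ring⟩
          mu_const := ⟨(-Real.log 2 - Real.log (ν p₀)) / 2, fun p hp => by
            have hpos := h.pos p hp
            have hG : 0 < coeffG x p := by rw [h.coeffG_eq hp]; positivity
            rw [mu_eq hG (by rw [h.halfDiff_eq hp₀]; exact h.pos p₀ hp₀)
              (by rwa [h.halfDiff_eq hp]), h.halfDiff_eq hp, h.halfDiff_eq hp₀, h.coeffG_eq hp,
              Real.log_inv, Real.log_mul two_ne_zero hpos.ne']
            ring⟩ }
      coeffE_base := by rw [h.coeffE_eq hp₀, h.halfDiff_eq hp₀, one_div]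
      coeffG_base := by rw [h.coeffG_eq hp₀, h.halfDiff_eq hp₀, one_div] }
  init_point := rfl
  init_X := h.tangentX_eq hp₀
  init_Y := h.tangentY_eq hp₀
  init_l := h.unitNormal_eq hp₀
  meanCurvature_eq _ hp := h.meanCurvature_eq hp
  nu₁_eq _ hp := h.nu₁_eq hp
  nu₂_eq _ hp := h.nu₂_eq hp
  gamma₁_eq _ hp := h.gamma₁_eq hp
  gamma₂_eq _ hp := h.gamma₂_eq hp

end SurfaceTheory

/-! ### Local existence, and frame equations recovered from inner products -/

namespace SurfaceTheory

/-- Bonnet's theorem for surfaces of constant mean curvature in canonical principal parameters: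
local existence. -/
theorem exists_isCMCSurface {m : ℕ∞} (hm : 1 ≤ m) (H : ℝ) {D : Set (ℝ × ℝ)} (hD : IsOpen D)
    {p₀ : ℝ × ℝ} (hp₀ : p₀ ∈ D) {ν : ℝ × ℝ → ℝ}
    (hν : ContDiffOn ℝ ((m : WithTop ℕ∞) + 1) ν D) (hpos : ∀ p ∈ D, 0 < ν p)
    (hne : ∀ p ∈ D, pdu ν p * pdv ν p ≠ 0)
    (heq : ∀ p ∈ D, pdu (pdu (fun q => Real.log (ν q))) p +
      pdv (pdv (fun q => Real.log (ν q))) p = (H ^ 2 - ν p ^ 2) / ν p)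
    {x₀ X₀ Y₀ l₀ : E3} (hframe : Orthonormal ℝ ![X₀, Y₀, l₀]) (horient : cross X₀ Y₀ = l₀) :
    ∃ D₀ : Set (ℝ × ℝ), IsOpen D₀ ∧ IsConnected D₀ ∧ p₀ ∈ D₀ ∧ D₀ ⊆ D ∧
      ∃ x : ℝ × ℝ → E3, IsCMCSurface ((m : WithTop ℕ∞) + 1 + 1) H ν p₀ x₀ X₀ Y₀ l₀ D₀ x := by
  have hm' : (1 : WithTop ℕ∞) ≤ m := by exact_mod_cast hm
  have hm0 : (m : WithTop ℕ∞) ≠ 0 := fun h => by simp [h] at hm'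
  have hνd : ∀ p ∈ D, DifferentiableAt ℝ ν p := fun p hp =>
    (hν.contDiffAt (hD.mem_nhds hp)).differentiableAt (by simp)
  have hlog : ContDiffOn ℝ ((m : WithTop ℕ∞) + 1) (fun q => Real.log (ν q)) D :=
    hν.log fun p hp => (hpos p hp).ne'
  have hu := contDiffOn_pdu hD hlog
  have hv := contDiffOn_pdv hD hlog
  have hs : ContDiffOn ℝ ((m : WithTop ℕ∞) + 1) (fun q => conformalFactor (ν q)) D := by
    refine ((contDiffOn_const.mul hν).sqrt fun p hp => ?_).inv fun p hp => ?_
    · have := hpos p hp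
      positivity
    · have := hpos p hp
      positivity
  have hs' := hs.of_le (show (m : WithTop ℕ∞) ≤ m + 1 from le_self_add)
  have hν' := hν.of_le (show (m : WithTop ℕ∞) ≤ m + 1 from le_self_add)
  obtain ⟨r, hr, hrD, x, X, Y, l, hfr, hxd, hxu, hxv, hX, hY, rfl, rfl, rfl, rfl⟩ :=
    exists_surface_frame hD hp₀ hm hs' (a₁ := coeffA₁ ν) (a₂ := coeffA₂ ν)
      (b := coeffB H ν) (d := coeffD H ν) (hv.div_const 2) (hu.div_const (-2))
      ((contDiffOn_const.add hν').mul hs') ((contDiffOn_const.sub hν').mul hs')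
      (fun p hp => pdu_conformalFactor (hνd p hp) (hpos p hp))
      (fun p hp => pdv_conformalFactor (hνd p hp) (hpos p hp))
      -- The Gauss equation: (a₂)_u - (a₁)_v = -(Δ ln ν)/2, which is where the differential equation
      -- for ν enters.
      (fun p hp => by
        have h1 := pdu_div_const ((hu.contDiffAt (hD.mem_nhds hp)).differentiableAt hm0) (-2)
        have h2 := pdv_div_const ((hv.contDiffAt (hD.mem_nhds hp)).differentiableAt hm0) 2
        rw [show pdu (coeffA₂ ν) p = _ from h1, show pdv (coeffA₁ ν) p = _ from h2,
          coeffB_mul_coeffD H (hpos p hp), ← heq p hp]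
        ring)
      (fun p hp => pdv_coeffB H (hνd p hp) (hpos p hp))
      (fun p hp => pdu_coeffD H (hνd p hp) (hpos p hp)) x₀ X₀ Y₀ l₀
  have hc : IsPreconnected (Metric.ball p₀ r) := (convex_ball p₀ r).isPreconnected
  have h0 : p₀ ∈ Metric.ball p₀ r := Metric.mem_ball_self hr
  have hS : IsFramedSurface H (Metric.ball p₀ r) ν x X Y l :=
    { isOpen := Metric.isOpen_ball
      diff_ν := fun p hp => hνd p (hrD hp)
      pos := fun p hp => hpos p (hrD hp)
      frame := hfr
      orthonormal := fun p hp => hfr.orthonormal Metric.isOpen_ball hc h0 hframe hp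
      cross_eq := fun p hp => hfr.cross_eq Metric.isOpen_ball hc h0 hframe horient hp
      pdu_eq := hxu
      pdv_eq := hxv }
  refine ⟨Metric.ball p₀ r, Metric.isOpen_ball, ⟨⟨p₀, h0⟩, hc⟩, h0, hrD, x,
    hS.isCMCSurface (fun p hp => hne p (hrD hp)) ?_ h0⟩
  -- The coefficients are only C^m, but the frame gains one degree. Since s is also C^(m+1), so are
  -- x_u = sX and x_v = sY, which makes x of class C^(m+2).
  exact contDiffOn_succ_of_partials (m := m + 1) Metric.isOpen_ball hxd
    (((hs.mono hrD).smul hX).congr hxu) (((hs.mono hrD).smul hY).congr hxv)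

/-- An orthonormal frame is determined by its mutual derivatives. -/
theorem FrameEquations.of_orthonormal {D : Set (ℝ × ℝ)} (hD : IsOpen D)
    {a₁ a₂ b d : ℝ × ℝ → ℝ} {X Y l : ℝ × ℝ → E3}
    (ho : ∀ p ∈ D, Orthonormal ℝ ![X p, Y p, l p])
    (dX : ∀ p ∈ D, DifferentiableAt ℝ X p) (dY : ∀ p ∈ D, DifferentiableAt ℝ Y p)
    (dl : ∀ p ∈ D, DifferentiableAt ℝ l p)
    (Xu_Y : ∀ p ∈ D, inner ℝ (pdu X p) (Y p) = a₁ p)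
    (Xv_Y : ∀ p ∈ D, inner ℝ (pdv X p) (Y p) = a₂ p)
    (Xu_l : ∀ p ∈ D, inner ℝ (pdu X p) (l p) = b p)
    (Xv_l : ∀ p ∈ D, inner ℝ (pdv X p) (l p) = (0 : ℝ))
    (Yu_l : ∀ p ∈ D, inner ℝ (pdu Y p) (l p) = (0 : ℝ))
    (Yv_l : ∀ p ∈ D, inner ℝ (pdv Y p) (l p) = d p) : FrameEquations D a₁ a₂ b d X Y l := by
  -- Differentiating a constant inner product gives skew-symmetry, so the listed products determine
  -- all components. For f = g it makes the diagonal ones vanish.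
  have ku : ∀ {f g : ℝ × ℝ → E3} {c : ℝ} {p : ℝ × ℝ}, p ∈ D → DifferentiableAt ℝ f p →
      DifferentiableAt ℝ g p → (∀ q ∈ D, inner ℝ (f q) (g q) = c) →
      inner ℝ (pdu g p) (f p) = -(inner ℝ (pdu f p) (g p) : ℝ) := by
    intro f g c p hp hf hg hc
    have h1 := pdu_inner hf hg
    have h2 : pdu (fun q => (inner ℝ (f q) (g q) : ℝ)) p = 0 := by
      rw [pdu_congr hD hp (k' := fun _ => c) hc]; simp [pdu]
    rw [real_inner_comm]
    linarith
  have kv : ∀ {f g : ℝ × ℝ → E3} {c : ℝ} {p : ℝ × ℝ}, p ∈ D → DifferentiableAt ℝ f p →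
      DifferentiableAt ℝ g p → (∀ q ∈ D, inner ℝ (f q) (g q) = c) →
      inner ℝ (pdv g p) (f p) = -(inner ℝ (pdv f p) (g p) : ℝ) := by
    intro f g c p hp hf hg hc
    have h1 := pdv_inner hf hg
    have h2 : pdv (fun q => (inner ℝ (f q) (g q) : ℝ)) p = 0 := by
      rw [pdv_congr hD hp (k' := fun _ => c) hc]; simp [pdv]
    rw [real_inner_comm]
    linarith
  have iXX : ∀ q ∈ D, inner ℝ (X q) (X q) = (1 : ℝ) := fun q hq =>
    (orthonormal_triple_iff.1 (ho q hq)).1.1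
  have iYY : ∀ q ∈ D, inner ℝ (Y q) (Y q) = (1 : ℝ) := fun q hq =>
    (orthonormal_triple_iff.1 (ho q hq)).1.2.1
  have ill : ∀ q ∈ D, inner ℝ (l q) (l q) = (1 : ℝ) := fun q hq =>
    (orthonormal_triple_iff.1 (ho q hq)).1.2.2
  have iXY : ∀ q ∈ D, inner ℝ (X q) (Y q) = (0 : ℝ) := fun q hq =>
    (orthonormal_triple_iff.1 (ho q hq)).2.1
  have iXl : ∀ q ∈ D, inner ℝ (X q) (l q) = (0 : ℝ) := fun q hq =>
    (orthonormal_triple_iff.1 (ho q hq)).2.2.1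
  have iYl : ∀ q ∈ D, inner ℝ (Y q) (l q) = (0 : ℝ) := fun q hq =>
    (orthonormal_triple_iff.1 (ho q hq)).2.2.2
  refine ⟨dX, dY, dl, fun p hp => ?_, fun p hp => ?_, fun p hp => ?_, fun p hp => ?_,
    fun p hp => ?_, fun p hp => ?_⟩
  · have h1 := ku hp (dX p hp) (dX p hp) iXX
    rw [eq_sum_of_orthonormal (ho p hp) (pdu X p), Xu_Y p hp, Xu_l p hp,
      self_eq_neg.1 h1, zero_smul, zero_add]
  · have h1 := kv hp (dX p hp) (dX p hp) iXX
    rw [eq_sum_of_orthonormal (ho p hp) (pdv X p), Xv_Y p hp, Xv_l p hp,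
      self_eq_neg.1 h1, zero_smul, zero_add, zero_smul, add_zero]
  · have h1 := ku hp (dY p hp) (dY p hp) iYY
    have h2 := ku hp (dX p hp) (dY p hp) iXY
    rw [eq_sum_of_orthonormal (ho p hp) (pdu Y p), h2, Xu_Y p hp, Yu_l p hp,
      self_eq_neg.1 h1, zero_smul, add_zero, zero_smul, add_zero]
  · have h1 := kv hp (dY p hp) (dY p hp) iYY
    have h2 := kv hp (dX p hp) (dY p hp) iXY
    rw [eq_sum_of_orthonormal (ho p hp) (pdv Y p), h2, Xv_Y p hp, Yv_l p hp,
      self_eq_neg.1 h1, zero_smul, add_zero]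
  · have h1 := ku hp (dl p hp) (dl p hp) ill
    have h2 := ku hp (dX p hp) (dl p hp) iXl
    have h3 := ku hp (dY p hp) (dl p hp) iYl
    rw [eq_sum_of_orthonormal (ho p hp) (pdu l p), h2, Xu_l p hp, h3, Yu_l p hp,
      self_eq_neg.1 h1, neg_zero, zero_smul, add_zero, zero_smul, add_zero]
  · have h1 := kv hp (dl p hp) (dl p hp) ill
    have h2 := kv hp (dX p hp) (dl p hp) iXl
    have h3 := kv hp (dY p hp) (dl p hp) iYl
    rw [eq_sum_of_orthonormal (ho p hp) (pdv l p), h2, Xv_l p hp, h3, Yv_l p hp,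
      self_eq_neg.1 h1, neg_zero, zero_smul, zero_add, zero_smul, add_zero]

/-! ### Uniqueness: every such surface is framed -/

section Uniqueness

variable {H : ℝ} {ν : ℝ × ℝ → ℝ} {p₀ : ℝ × ℝ} {x₀ X₀ Y₀ l₀ : E3} {D : Set (ℝ × ℝ)}
  {x : ℝ × ℝ → E3}

theorem IsCMCSurface.halfDiff_eq {k : WithTop ℕ∞} (h : IsCMCSurface k H ν p₀ x₀ X₀ Y₀ l₀ D x)
    {p : ℝ × ℝ} (hp : p ∈ D) : halfDiff x p = ν p := by
  rw [halfDiff, h.nu₁_eq p hp, h.nu₂_eq p hp]; ring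

theorem IsCMCSurface.coeffE_pos {k : WithTop ℕ∞} (h : IsCMCSurface k H ν p₀ x₀ X₀ Y₀ l₀ D x)
    {p : ℝ × ℝ} (hp : p ∈ D) : 0 < coeffE x p :=
  real_inner_self_pos.2 ((h.stronglyRegular.regular.immersion p hp).ne_zero 0)

theorem IsCMCSurface.coeffG_pos {k : WithTop ℕ∞} (h : IsCMCSurface k H ν p₀ x₀ X₀ Y₀ l₀ D x)
    {p : ℝ × ℝ} (hp : p ∈ D) : 0 < coeffG x p :=
  real_inner_self_pos.2 ((h.stronglyRegular.regular.immersion p hp).ne_zero 1)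

theorem eq_inv_of_log_eq {e ν ν₀ : ℝ} (he : 0 < e) (hν : 0 < ν) (hν₀ : 0 < ν₀)
    (h : (Real.log e + Real.log ν - Real.log ν₀) / 2 =
      (Real.log (1 / (2 * ν₀)) + Real.log ν₀ - Real.log ν₀) / 2) : e = (2 * ν)⁻¹ := by
  refine Real.log_injOn_pos he (show (0 : ℝ) < (2 * ν)⁻¹ by positivity) ?_
  rw [one_div, Real.log_inv, Real.log_mul two_ne_zero hν₀.ne'] at h
  rw [Real.log_inv, Real.log_mul two_ne_zero hν.ne']
  linarith

/-- Constancy of λ makes Eν constant, and the normalization at p₀ fixes the constant as 1/2. -/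
theorem IsCMCSurface.coeffE_eq {k : WithTop ℕ∞} (h : IsCMCSurface k H ν p₀ x₀ X₀ Y₀ l₀ D x)
    (hpos : ∀ p ∈ D, 0 < ν p) (hp₀ : p₀ ∈ D) {p : ℝ × ℝ} (hp : p ∈ D) :
    coeffE x p = (2 * ν p)⁻¹ := by
  obtain ⟨c, hc⟩ := h.canonical.geometric.lam_const
  have h1 := (hc p hp).trans (hc p₀ hp₀).symm
  have hν0 : 0 < halfDiff x p₀ := by rw [h.halfDiff_eq hp₀]; exact hpos p₀ hp₀
  rw [lam_eq (h.coeffE_pos hp) hν0 (by rw [h.halfDiff_eq hp]; exact hpos p hp),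
    lam_eq (h.coeffE_pos hp₀) hν0 hν0, h.canonical.coeffE_base, h.halfDiff_eq hp,
    h.halfDiff_eq hp₀] at h1
  exact eq_inv_of_log_eq (h.coeffE_pos hp) (hpos p hp) (hpos p₀ hp₀) h1

theorem IsCMCSurface.coeffG_eq {k : WithTop ℕ∞} (h : IsCMCSurface k H ν p₀ x₀ X₀ Y₀ l₀ D x)
    (hpos : ∀ p ∈ D, 0 < ν p) (hp₀ : p₀ ∈ D) {p : ℝ × ℝ} (hp : p ∈ D) :
    coeffG x p = (2 * ν p)⁻¹ := by
  obtain ⟨c, hc⟩ := h.canonical.geometric.mu_const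
  have h1 := (hc p hp).trans (hc p₀ hp₀).symm
  have hν0 : 0 < halfDiff x p₀ := by rw [h.halfDiff_eq hp₀]; exact hpos p₀ hp₀
  rw [mu_eq (h.coeffG_pos hp) hν0 (by rw [h.halfDiff_eq hp]; exact hpos p hp),
    mu_eq (h.coeffG_pos hp₀) hν0 hν0, h.canonical.coeffG_base, h.halfDiff_eq hp,
    h.halfDiff_eq hp₀] at h1
  exact eq_inv_of_log_eq (h.coeffG_pos hp) (hpos p hp) (hpos p₀ hp₀) h1

/-- The symmetry of the mixed partial derivatives of a `C²` map. -/
theorem pdv_pdu_eq {F : Type*} [NormedAddCommGroup F] [NormedSpace ℝ F] {f : ℝ × ℝ → F}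
    {p : ℝ × ℝ} (hf : ContDiffAt ℝ 2 f p) : pdv (pdu f) p = pdu (pdv f) p := by
  have hs : IsSymmSndFDerivAt ℝ f p := hf.isSymmSndFDerivAt (by simp)
  have hd : DifferentiableAt ℝ (fderiv ℝ f) p :=
    (hf.fderiv_right (m := 1) le_rfl).differentiableAt one_ne_zero
  have key : ∀ e : ℝ × ℝ, fderiv ℝ (fun q => fderiv ℝ f q e) p =
      (fderiv ℝ (fderiv ℝ f) p).flip e := by
    intro e
    have := (hd.hasFDerivAt.clm_apply (hasFDerivAt_const e p)).fderiv
    simpa using this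
  have h1 := hs (0, 1) (1, 0)
  calc pdv (pdu f) p = fderiv ℝ (fun q => fderiv ℝ f q (1, 0)) p (0, 1) := rfl
    _ = fderiv ℝ (fun q => fderiv ℝ f q (0, 1)) p (1, 0) := by
      rw [key, key]; exact h1
    _ = pdu (pdv f) p := rfl

/-- The unit frame of a surface of constant mean curvature in canonical principal parameters solves
the derivation equations. -/
theorem IsCMCSurface.isFramedSurface (h : IsCMCSurface 2 H ν p₀ x₀ X₀ Y₀ l₀ D x) (hD : IsOpen D)
    (hν : ∀ p ∈ D, DifferentiableAt ℝ ν p) (hpos : ∀ p ∈ D, 0 < ν p) (hp₀ : p₀ ∈ D) :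
    ∃ X Y l : ℝ × ℝ → E3, IsFramedSurface H D ν x X Y l := by
  set s : ℝ × ℝ → ℝ := fun q => (conformalFactor (ν q))⁻¹ with hs
  have ssq : ∀ p ∈ D, s p * s p = 2 * ν p := fun p hp => by
    rw [hs, ← mul_inv, conformalFactor_mul_self (hpos p hp), inv_inv]
  have hx : ∀ p ∈ D, ContDiffAt ℝ 2 x p := fun p hp =>
    h.stronglyRegular.regular.contDiffOn.contDiffAt (hD.mem_nhds hp)
  have hfd : ∀ p ∈ D, DifferentiableAt ℝ (fderiv ℝ x) p := fun p hp =>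
    ((hx p hp).fderiv_right (m := 1) le_rfl).differentiableAt one_ne_zero
  have du : ∀ p ∈ D, DifferentiableAt ℝ (pdu x) p := fun p hp =>
    (hfd p hp).clm_apply (differentiableAt_const _)
  have dv : ∀ p ∈ D, DifferentiableAt ℝ (pdv x) p := fun p hp =>
    (hfd p hp).clm_apply (differentiableAt_const _)
  have ds : ∀ p ∈ D, DifferentiableAt ℝ s p := fun p hp =>
    ((hasDerivAt_conformalFactor (hpos p hp)).differentiableAt.comp p (hν p hp)).inv
      (conformalFactor_pos (hpos p hp)).ne'
  have hE : ∀ p ∈ D, inner ℝ (pdu x p) (pdu x p) = (2 * ν p)⁻¹ := fun p hp =>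
    h.coeffE_eq hpos hp₀ hp
  have hG : ∀ p ∈ D, inner ℝ (pdv x p) (pdv x p) = (2 * ν p)⁻¹ := fun p hp =>
    h.coeffG_eq hpos hp₀ hp
  have hF : ∀ p ∈ D, inner ℝ (pdu x p) (pdv x p) = (0 : ℝ) := fun p hp =>
    (h.stronglyRegular.principal p hp).1
  set X : ℝ × ℝ → E3 := fun q => s q • pdu x q with hX
  set Y : ℝ × ℝ → E3 := fun q => s q • pdv x q with hY
  -- Taking l as X × Y makes its differentiability immediate; `hn` identifies it with the unit
  -- normal.
  set l : ℝ × ℝ → E3 := fun q => cross (X q) (Y q) with hl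
  have dX : ∀ p ∈ D, DifferentiableAt ℝ X p := fun p hp => (ds p hp).smul (du p hp)
  have dY : ∀ p ∈ D, DifferentiableAt ℝ Y p := fun p hp => (ds p hp).smul (dv p hp)
  have iXX : ∀ p ∈ D, inner ℝ (X p) (X p) = (1 : ℝ) := fun p hp => by
    have := hpos p hp
    rw [hX, real_inner_smul_left, real_inner_smul_right, hE p hp, ← mul_assoc, ssq p hp]
    field_simp
  have iYY : ∀ p ∈ D, inner ℝ (Y p) (Y p) = (1 : ℝ) := fun p hp => by
    have := hpos p hp
    rw [hY, real_inner_smul_left, real_inner_smul_right, hG p hp, ← mul_assoc, ssq p hp]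
    field_simp
  have iXY : ∀ p ∈ D, inner ℝ (X p) (Y p) = (0 : ℝ) := fun p hp => by
    rw [hX, hY, real_inner_smul_left, real_inner_smul_right, hF p hp, mul_zero, mul_zero]
  have iXl : ∀ p, inner ℝ (X p) (l p) = (0 : ℝ) := fun p => by
    rw [real_inner_comm, hl, inner_cross_left]
  have iYl : ∀ p, inner ℝ (Y p) (l p) = (0 : ℝ) := fun p => by
    rw [real_inner_comm, hl, inner_cross_right]
  have ill : ∀ p ∈ D, inner ℝ (l p) (l p) = (1 : ℝ) := fun p hp => by
    rw [hl, inner_cross_self, iXX p hp, iYY p hp, iXY p hp]; norm_num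
  have ho : ∀ p ∈ D, Orthonormal ℝ ![X p, Y p, l p] := fun p hp =>
    orthonormal_triple_iff.2 ⟨⟨iXX p hp, iYY p hp, ill p hp⟩, iXY p hp, iXl p, iYl p⟩
  have hxu : ∀ p ∈ D, pdu x p = conformalFactor (ν p) • X p := fun p hp => by
    rw [hX, hs, smul_smul, mul_inv_cancel₀ (conformalFactor_pos (hpos p hp)).ne', one_smul]
  have hxv : ∀ p ∈ D, pdv x p = conformalFactor (ν p) • Y p := fun p hp => by
    rw [hY, hs, smul_smul, mul_inv_cancel₀ (conformalFactor_pos (hpos p hp)).ne', one_smul]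
  have hn : ∀ p ∈ D, unitNormal x p = l p := fun p hp => by
    have hc := conformalFactor_pos (hpos p hp)
    have hl1 : ‖l p‖ = 1 := (ho p hp).1 2
    rw [unitNormal, hxu p hp, hxv p hp, cross_smul_smul,
      show cross (X p) (Y p) = l p from rfl, norm_smul, hl1,
      mul_one, Real.norm_of_nonneg (by positivity), smul_smul, inv_mul_cancel₀ (by positivity),
      one_smul]
  have hd : ∀ p ∈ D, HasDerivAt (fun t : ℝ => (2 * t)⁻¹) (-(2 * 1) / (2 * ν p) ^ 2) (ν p) :=
    fun p hp => ((hasDerivAt_id (ν p)).const_mul 2).inv (by simp [(hpos p hp).ne'])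
  have Xu : ∀ p ∈ D, pdu X p = s p • pdu (pdu x) p + pdu s p • pdu x p := fun p hp =>
    pdu_smul (ds p hp) (du p hp)
  have Xv : ∀ p ∈ D, pdv X p = s p • pdv (pdu x) p + pdv s p • pdu x p := fun p hp =>
    pdv_smul (ds p hp) (du p hp)
  have Yu : ∀ p ∈ D, pdu Y p = s p • pdu (pdv x) p + pdu s p • pdv x p := fun p hp =>
    pdu_smul (ds p hp) (dv p hp)
  have Yv : ∀ p ∈ D, pdv Y p = s p • pdv (pdv x) p + pdv s p • pdv x p := fun p hp =>
    pdv_smul (ds p hp) (dv p hp)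
  have ul : ∀ p ∈ D, inner ℝ (pdu x p) (l p) = (0 : ℝ) := fun p hp => by
    rw [hxu p hp, real_inner_smul_left, iXl, mul_zero]
  have vl : ∀ p ∈ D, inner ℝ (pdv x p) (l p) = (0 : ℝ) := fun p hp => by
    rw [hxv p hp, real_inner_smul_left, iYl, mul_zero]
  have hL : ∀ p ∈ D, inner ℝ (pdu (pdu x) p) (l p) = (H + ν p) * (2 * ν p)⁻¹ := fun p hp => by
    have h1 := h.nu₁_eq p hp
    rw [nu₁, div_eq_iff (h.coeffE_pos hp).ne', h.coeffE_eq hpos hp₀ hp, coeffL, hn p hp] at h1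
    exact h1
  have hN : ∀ p ∈ D, inner ℝ (pdv (pdv x) p) (l p) = (H - ν p) * (2 * ν p)⁻¹ := fun p hp => by
    have h1 := h.nu₂_eq p hp
    rw [nu₂, div_eq_iff (h.coeffG_pos hp).ne', h.coeffG_eq hpos hp₀ hp, coeffN, hn p hp] at h1
    exact h1
  have hM : ∀ p ∈ D, inner ℝ (pdv (pdu x) p) (l p) = (0 : ℝ) := fun p hp => by
    have h1 := (h.stronglyRegular.principal p hp).2
    rwa [coeffM, hn p hp] at h1
  refine ⟨X, Y, l, hD, hν, hpos, FrameEquations.of_orthonormal hD ho dX dY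
    (fun p hp => differentiableAt_cross (dX p hp) (dY p hp)) (fun p hp => ?_) (fun p hp => ?_)
    (fun p hp => ?_) (fun p hp => ?_) (fun p hp => ?_) (fun p hp => ?_), ho, fun p _ => rfl,
    hxu, hxv⟩
  -- Differentiating F = 0 in u and E = 1/(2ν) in v gives x_uu · x_v = -x_u · x_uv = -E_v/2 =
  -- ν_v/(2ν)².
  · have h1 := pdu_inner (du p hp) (dv p hp)
    have h2 : pdu (fun q => (inner ℝ (pdu x q) (pdv x q) : ℝ)) p = 0 := by
      rw [pdu_congr hD hp (k' := fun _ => (0 : ℝ)) hF]; simp [pdu]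
    have h3 := pdv_inner (du p hp) (du p hp)
    rw [pdv_congr hD hp (k' := fun q => (2 * ν q)⁻¹) hE, pdv_comp (hd p hp) (hν p hp),
      real_inner_comm, pdv_pdu_eq (hx p hp)] at h3
    rw [real_inner_comm] at h3
    have hp' := hpos p hp
    rw [Xu p hp, inner_add_left, real_inner_smul_left, real_inner_smul_left, hY,
      real_inner_smul_right, real_inner_smul_right, hF p hp, ← mul_assoc, ssq p hp,
      coeffA₁_eq (hν p hp) hp', show (inner ℝ (pdu (pdu x) p) (pdv x p) : ℝ) =
        pdv ν p / (2 * ν p) ^ 2 by rw [h2] at h1; linear_combination -h1 + h3 / 2]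
    field_simp
    ring
  -- Similarly x_uv · x_v = G_u/2 = -ν_u/(2ν)².
  · have h3 := pdu_inner (dv p hp) (dv p hp)
    rw [pdu_congr hD hp (k' := fun q => (2 * ν q)⁻¹) hG, pdu_comp (hd p hp) (hν p hp),
      real_inner_comm, ← pdv_pdu_eq (hx p hp)] at h3
    have hp' := hpos p hp
    rw [Xv p hp, inner_add_left, real_inner_smul_left, real_inner_smul_left, hY,
      real_inner_smul_right, real_inner_smul_right, hF p hp, ← mul_assoc, ssq p hp,
      coeffA₂_eq (hν p hp) hp', show (inner ℝ (pdv (pdu x) p) (pdv x p) : ℝ) =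
        -(pdu ν p / (2 * ν p) ^ 2) by linear_combination -h3 / 2]
    field_simp
    ring
  · have hp' := hpos p hp
    have hc := conformalFactor_pos hp'
    rw [Xu p hp, inner_add_left, real_inner_smul_left, real_inner_smul_left, ul p hp, hL p hp,
      coeffB, ← conformalFactor_mul_self hp', hs]
    field_simp
    ring
  · rw [Xv p hp, inner_add_left, real_inner_smul_left, real_inner_smul_left, ul p hp, hM p hp]
    ring
  · rw [Yu p hp, inner_add_left, real_inner_smul_left, real_inner_smul_left, vl p hp,
      ← pdv_pdu_eq (hx p hp), hM p hp]
    ring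
  · have hp' := hpos p hp
    have hc := conformalFactor_pos hp'
    rw [Yv p hp, inner_add_left, real_inner_smul_left, real_inner_smul_left, vl p hp, hN p hp,
      coeffD, ← conformalFactor_mul_self hp', hs]
    field_simp
    ring

/-- Uniqueness of surfaces of constant mean curvature in canonical principal parameters. -/
theorem IsCMCSurface.eqOn {y : ℝ × ℝ → E3} (hx : IsCMCSurface 2 H ν p₀ x₀ X₀ Y₀ l₀ D x)
    (hy : IsCMCSurface 2 H ν p₀ x₀ X₀ Y₀ l₀ D y) (hD : IsOpen D) (hc : IsPreconnected D)
    (hν : ∀ p ∈ D, DifferentiableAt ℝ ν p) (hpos : ∀ p ∈ D, 0 < ν p) (hp₀ : p₀ ∈ D) :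
    EqOn x y D := by
  obtain ⟨X, Y, l, h⟩ := hx.isFramedSurface hD hν hpos hp₀
  obtain ⟨X', Y', l', h'⟩ := hy.isFramedSurface hD hν hpos hp₀
  have key : ∀ p ∈ D, X p = X' p ∧ Y p = Y' p ∧ l p = l' p := fun p hp =>
    h.frame.eq_of_orthonormal h'.frame hD hc h.orthonormal h'.orthonormal hp₀
      (by rw [← h.tangentX_eq hp₀, ← h'.tangentX_eq hp₀, hx.init_X, hy.init_X])
      (by rw [← h.tangentY_eq hp₀, ← h'.tangentY_eq hp₀, hx.init_Y, hy.init_Y])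
      (by rw [← h.unitNormal_eq hp₀, ← h'.unitNormal_eq hp₀, hx.init_l, hy.init_l]) hp
  have diff : ∀ {z : ℝ × ℝ → E3}, IsCMCSurface 2 H ν p₀ x₀ X₀ Y₀ l₀ D z →
      ∀ p ∈ D, DifferentiableAt ℝ z p := fun hz p hp =>
    (hz.stronglyRegular.regular.contDiffOn.contDiffAt (hD.mem_nhds hp)).differentiableAt (by simp)
  exact eqOn_of_partials_eq hD hc (diff hx) (diff hy)
    (fun p hp => by rw [h.pdu_eq p hp, h'.pdu_eq p hp, (key p hp).1])
    (fun p hp => by rw [h.pdv_eq p hp, h'.pdv_eq p hp, (key p hp).2.1]) hp₀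
    (by rw [hx.init_point, hy.init_point])

end Uniqueness

end SurfaceTheory

theorem corollary5p1 (n : ℕ∞) (hn : 2 ≤ n) (H : ℝ) (D : Set (ℝ × ℝ)) (hD : IsOpen D)
    (p₀ : ℝ × ℝ) (hp₀ : p₀ ∈ D) (ν : ℝ × ℝ → ℝ)
    (hν : ContDiffOn ℝ (n : WithTop ℕ∞) ν D)
    (hpos : ∀ p ∈ D, 0 < ν p)
    (hne : ∀ p ∈ D, SurfaceTheory.pdu ν p * SurfaceTheory.pdv ν p ≠ 0)
    (heq : ∀ p ∈ D,
      SurfaceTheory.pdu (SurfaceTheory.pdu (fun q => Real.log (ν q))) p +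
        SurfaceTheory.pdv (SurfaceTheory.pdv (fun q => Real.log (ν q))) p =
      (H ^ 2 - ν p ^ 2) / ν p)
    (x₀ X₀ Y₀ l₀ : SurfaceTheory.E3)
    (hframe : Orthonormal ℝ ![X₀, Y₀, l₀]) (horient : SurfaceTheory.cross X₀ Y₀ = l₀) :
    (∃ D₀ : Set (ℝ × ℝ), IsOpen D₀ ∧ IsConnected D₀ ∧ p₀ ∈ D₀ ∧ D₀ ⊆ D ∧
      ∃ x : ℝ × ℝ → SurfaceTheory.E3,
        SurfaceTheory.IsCMCSurface ((n : WithTop ℕ∞) + 1) H ν p₀ x₀ X₀ Y₀ l₀ D₀ x) ∧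
    (∀ D₁ : Set (ℝ × ℝ), IsOpen D₁ → IsConnected D₁ → p₀ ∈ D₁ → D₁ ⊆ D →
      ∀ x y : ℝ × ℝ → SurfaceTheory.E3,
        SurfaceTheory.IsCMCSurface 2 H ν p₀ x₀ X₀ Y₀ l₀ D₁ x →
        SurfaceTheory.IsCMCSurface 2 H ν p₀ x₀ X₀ Y₀ l₀ D₁ y →
        Set.EqOn x y D₁) := by

  -- The connection coefficients contain first derivatives of ν, so the system has class m = n - 1.
  -- The condition n ≥ 2 gives m ≥ 1, so that the integrability condition makes sense with
  -- continuous derivatives; n = ∞ gives m = ∞.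
  obtain ⟨m, rfl⟩ : ∃ m : ℕ∞, n = m + 1 :=
    ⟨n - 1, (tsub_add_cancel_of_le (le_trans (by norm_num) hn)).symm⟩
  have hm : 1 ≤ m := by
    rw [← one_add_one_eq_two] at hn
    exact (ENat.add_le_add_iff_right ENat.one_ne_top).1 hn
  refine ⟨SurfaceTheory.exists_isCMCSurface hm H hD hp₀ hν hpos hne heq hframe horient, ?_⟩
  intro D₁ hD₁ hc hp₁ hsub x y hx hy
  exact hx.eqOn hy hD₁ hc.isPreconnected
    (fun p hp => (hν.contDiffAt (hD.mem_nhds (hsub hp))).differentiableAt (by simp))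
    (fun p hp => hpos p (hsub hp)) hp₁
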